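/- There is a universal constant $c>0$ such that the following holds. Let $(\Omega,\mathcal F,\mathbb P,(\mathcal F_t)_{t\ge 0})$ be a filtered probability space and let $\beta$ be a standard real Brownian motion relative to $(\mathcal F_t)_{t\ge0}$, i.e. $\beta$ is an $(\mathcal F_t)$-adapted Brownian motion and $\beta(t)-\beta(s)$ is independent of $\mathcal F_s$ for all $0\le s\le t$. All function spaces consist of complex-valued functions. For $0\le s\le t$ let $S(t,s)$ be the (random, unitary) propagator on $L^2(\mathbb R)$ of the linear Schrödinger equation with white noise dispersion $i\,du+\Delta u\circ d\beta=0$, that is, the Fourier multiplier $$\widehat{S(t,s)f}(\xi)=e^{-i|\xi|^2(\beta(t)-\beta(s))}\hat f(\xi),\qquad f\in L^2(\mathbb R),$$ where $\hat f(\xi)$ denotes the Fourier transform of $f$ at the angular frequency $\xi$. Let $s\ge 0$, $T\ge 0$, and let $u_s\in L^4(\Omega;L^2(\mathbb R))$ be $\mathcal F_s$-measurable. Then $t\mapsto S(t,s)u_s$ belongs to $L^4_{\mathcal P}(\Omega;L^5(s,s+T;L^{10}(\mathbb R)))$, the subspace of $L^4(\Omega;L^5(s,s+T;L^{10}(\mathbb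 R)))$ consisting of (classes of) predictable processes, and $$\|S(\cdot,s)u_s\|_{L^4(\Omega;L^5(s,s+T;L^{10}(\mathbb R)))}\le c\,T^{1/10}\,\|u_s\|_{L^4(\Omega;L^2(\mathbb R))}.$$ -/

import Mathlib

open MeasureTheory ProbabilityTheory Filter
open scoped NNReal ENNReal FourierTransform

/-- `5` and `10` are admissible Lebesgue exponents. -/
instance fact_one_le_five : Fact ((1 : ℝ≥0∞) ≤ 5) := ⟨by norm_num⟩

instance fact_one_le_ten : Fact ((1 : ℝ≥0∞) ≤ 10) := ⟨by norm_num⟩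

/-- The multiplier of `exp (i a Δ)` on the line. Mathlib's Fourier transform is
`𝓕 f ξ = ∫ exp (-2πi x ξ) f x dx`, hence the angular frequency is `2πξ`. -/
noncomputable def schrodingerSymbol (a : ℝ) (ξ : ℝ) : ℂ :=
  Complex.exp (-(Complex.I * ((a * (2 * Real.pi * ξ) ^ 2 : ℝ) : ℂ)))

theorem norm_schrodingerSymbol (a ξ : ℝ) : ‖schrodingerSymbol a ξ‖ = 1 := by
  rw [schrodingerSymbol, Complex.norm_exp]
  simp [-Complex.ofReal_mul, -Complex.ofReal_pow]

theorem memLp_schrodingerSymbol_mul (a : ℝ) (g : Lp ℂ 2 (volume : Measure ℝ)) :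
    MemLp (fun ξ ↦ schrodingerSymbol a ξ * g ξ) 2 (volume : Measure ℝ) := by
  have hc : Continuous (schrodingerSymbol a) := by
    unfold schrodingerSymbol
    fun_prop
  refine (Lp.memLp g).of_le (hc.aestronglyMeasurable.mul (Lp.memLp g).1) ?_
  exact Eventually.of_forall fun ξ ↦ by simp [norm_schrodingerSymbol]

/-- The unitary Schrödinger group `exp (i a Δ)` on `L²(ℝ)`, as a Fourier multiplier. -/
noncomputable def schrodingerGroup (a : ℝ) (f : Lp ℂ 2 (volume : Measure ℝ)) :
    Lp ℂ 2 (volume : Measure ℝ) :=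
  𝓕⁻ ((memLp_schrodingerSymbol_mul a (𝓕 f)).toLp)

/-- The propagator `S(t, s)` of the linear Schrödinger equation with white noise dispersion
`i du + Δu ∘ dβ = 0`, along the path `ω`: on the Fourier side (angular frequency `η`) it is
multiplication by `exp (-i η² (β t - β s))`. -/
noncomputable def whiteNoisePropagator {Ω : Type*} (β : ℝ≥0 → Ω → ℝ) (t s : ℝ≥0) (ω : Ω)
    (f : Lp ℂ 2 (volume : Measure ℝ)) : Lp ℂ 2 (volume : Measure ℝ) :=
  schrodingerGroup (β t ω - β s ω) f

/-- `β` is a (standard, real) Brownian motion relative to the filtration `𝓕t`: a Brownian motion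
that is adapted and whose increments after time `s` are independent of `𝓕t s`. -/
structure IsBrownianRelTo {Ω : Type*} {mΩ : MeasurableSpace Ω} (β : ℝ≥0 → Ω → ℝ)
    (𝓕t : Filtration ℝ≥0 mΩ) (P : Measure Ω) : Prop where
  isBrownian : IsBrownianReal β P
  adapted : StronglyAdapted 𝓕t β
  indep : ∀ s t : ℝ≥0, s ≤ t →
    Indep (MeasurableSpace.comap (fun ω ↦ β t ω - β s ω) inferInstance) (𝓕t s) P

/-- `V` represents an element of `L^r_𝓟(Ω; L^p(a, b; K))`, for `0 ≤ a`: it is an element of the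
Bochner space `L^r(Ω; L^p(a, b; K))` which is given by a predictable process `v`. Times `t` of the
interval `(a, b)` are nonnegative, so that `t.toNNReal` is just `t`. -/
structure MemPredictableLp {Ω K : Type*} {mΩ : MeasurableSpace Ω} [NormedAddCommGroup K]
    (𝓕t : Filtration ℝ≥0 mΩ) (P : Measure Ω) (r p : ℝ≥0∞) [Fact (1 ≤ p)] (a b : ℝ≥0)
    (V : Ω → Lp K p ((volume : Measure ℝ).restrict (Set.Ioo (a : ℝ) b))) : Prop where
  memLp : MemLp V r P
  predictable : ∃ v : ℝ≥0 → Ω → K, IsStronglyPredictable 𝓕t v ∧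
    ∀ᵐ ω ∂P, ∀ᵐ t ∂((volume : Measure ℝ).restrict (Set.Ioo (a : ℝ) b)), V ω t = v t.toNNReal ω

/-!
The estimate is the deterministic Strichartz inequality of the free Schrödinger group for the pair
`(5, 10)`, seen through the law of the Brownian increments.

Write `G a f = ‖exp (i a Δ) f‖⁵` with the norm of `L¹⁰(ℝ)`. The law of `β t - β s` is `N(0, t - s)`,
whose density is at most `(2π (t - s))^{-1/2}`, so that for an independent datum `f` the mean of
`G (β t - β s) f` is at most `(2π (t - s))^{-1/2} ∫ G a f da`, and Strichartz bounds the last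
integral by `C ‖f‖⁵` (`strichartz`). Integrating in `t` over an interval of length `T` produces
`T^{1/2}`. To reach the fourth moment, this is applied to `G / ‖f‖`, whose mean is of order
`‖f‖⁴` (`lintegral_strichartzDensity_comp_le`), and `‖f‖` is put back by Hölder's inequality
(`lintegral_whiteNoise_rpow_le`); the power of `T` becomes `(1/2) (4/5) (1/4) = 1/10`.

The Strichartz inequality is proved by a bilinear argument, in which no oscillatory integral is
estimated. Let `v a = |exp (i a Δ) f|²`. Its Fourier transform at the frequency `p` is the
autocorrelation at `p` of the Fourier transform `g` of the solution, and since
`ξ² - (ξ - p)²` is affine in `ξ`, this is, up to a phase, the Fourier transform of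
`ξ ↦ g ξ * conj (g (ξ - p))` at a multiple of `p a`. Plancherel in `a` gains `1 / |p|`, which is
exactly the weight lost in the homogeneous `H^{1/2}` seminorm: the integral over `a` of the squared
seminorm of `v a` is at most `C ‖f‖⁴` (`lintegral_gagliardoDensity_schrodinger_le`). The
Gagliardo–Nirenberg inequality `‖v‖₅⁵ ≤ C ‖v‖₁ ‖v‖⁴_{H^{1/2}}` (`lintegral_pow_five_le`) turns this
into a bound for `‖v a‖₅^{5/2} = G a f`. This is done for Schwartz data and extended by Fatou's
lemma.

Two measurability questions remain. A map into a separable Lebesgue space is strongly measurable as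
soon as its distances to fixed elements are measurable; this applies to the classes of
`exp (i a Δ) f` in `L¹⁰`, whose norms are lower semicontinuous in `(a, f)`, and to `V`. Since the
paths of `β` are only almost surely continuous, and the filtration is not assumed complete,
predictability is obtained for a limit of grid approximations of `β` from the left, which equals
`β` on every continuous path (`exists_predictable_eq_of_continuous`).
-/

/-! ### Fourier transform of integrable square-integrable functions -/

theorem Real.continuous_fourier_of_integrable {F : ℝ → ℂ} (hF : Integrable F) :
    Continuous (𝓕 F) :=
  VectorFourier.fourierIntegral_continuous Real.continuous_fourierChar
    (innerSL ℝ).continuous₂ hF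

/-- On `L¹ ∩ L²`, the inverse Fourier transform of `L²` is the inverse Fourier integral: both
are the same tempered distribution. -/
theorem fourierInv_toLp_ae_eq {F : ℝ → ℂ} (hF : Integrable F)
    (hF2 : MemLp F 2 (volume : Measure ℝ)) :
    ((𝓕⁻ hF2.toLp : Lp ℂ 2 (volume : Measure ℝ)) : ℝ → ℂ) =ᵐ[volume] 𝓕⁻ F := by
  have hc : Continuous (𝓕⁻ F) := by
    have : 𝓕⁻ F = fun x ↦ 𝓕 F (-x) := by
      ext x; rw [Real.fourierInv_eq_fourier_neg]
    rw [this]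
    exact (Real.continuous_fourier_of_integrable hF).comp continuous_neg
  refine ae_eq_of_integral_contDiff_smul_eq
    ((Lp.memLp _).locallyIntegrable (by norm_num)) hc.locallyIntegrable ?_
  -- Test against `φ`, seen as a Schwartz function `ψ`.
  intro φ hφ hφc
  have hψ : ContDiff ℝ ((⊤ : ℕ∞) : WithTop ℕ∞) (fun x ↦ (φ x : ℂ)) :=
    Complex.ofRealCLM.contDiff.comp hφ
  have hψc : HasCompactSupport (fun x ↦ (φ x : ℂ)) := hφc.comp_left (g := Complex.ofReal) (by simp)
  set ψ : SchwartzMap ℝ ℂ := hψc.toSchwartzMap hψ with hψdef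
  have hval : ∀ x, ψ x = (φ x : ℂ) := fun x ↦ rfl
  have key := congrArg (fun D : TemperedDistribution ℝ ℂ ↦ D ψ)
    (Lp.fourierInv_toTemperedDistribution_eq (hF2.toLp : Lp ℂ 2 (volume : Measure ℝ)))
  simp only [TemperedDistribution.fourierInv_apply, Lp.toTemperedDistribution_apply] at key
  have e1 : ∫ x, (𝓕⁻ ψ) x • (hF2.toLp : Lp ℂ 2 (volume : Measure ℝ)) x
      = ∫ x, 𝓕⁻ (ψ : ℝ → ℂ) x • F x := by
    refine integral_congr_ae ?_
    filter_upwards [hF2.coeFn_toLp] with x hx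
    rw [hx, SchwartzMap.fourierInv_coe]
  have e2 : ∫ x, 𝓕⁻ (ψ : ℝ → ℂ) x • F x = ∫ x, ψ x • 𝓕⁻ F x := by
    have := VectorFourier.integral_fourierIntegral_smul_eq_flip (μ := volume) (ν := volume)
      (e := Real.fourierChar) (L := -innerₗ ℝ)
      Real.continuous_fourierChar
      (by simp only [LinearMap.neg_apply, innerₗ_apply_apply]; exact continuous_inner.neg)
      ψ.integrable hF
    have hfl : (-innerₗ ℝ : ℝ →ₗ[ℝ] ℝ →ₗ[ℝ] ℝ).flip = -innerₗ ℝ := by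
      ext; simp
    rw [hfl] at this
    exact this
  have h3 := key.symm.trans (e1.trans e2)
  simpa [hval] using h3

theorem lintegral_enorm_toLp_sq {α : Type*} {mα : MeasurableSpace α} {μ : Measure α}
    (f : Lp ℂ 2 μ) : ∫⁻ x, ‖f x‖ₑ ^ 2 ∂μ = ‖f‖ₑ ^ 2 := by
  rw [Lp.enorm_def, eLpNorm_eq_lintegral_rpow_enorm_toReal (by norm_num) (by norm_num),
    ← ENNReal.rpow_natCast, ← ENNReal.rpow_mul]
  norm_num

/-- Plancherel's inequality for an integrable function, square-integrable or not. -/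
theorem lintegral_fourier_sq_le {F : ℝ → ℂ} (hF : Integrable F) :
    ∫⁻ x, ‖𝓕 F x‖ₑ ^ 2 ≤ ∫⁻ x, ‖F x‖ₑ ^ 2 := by
  by_cases hfin : ∫⁻ x, ‖F x‖ₑ ^ 2 = ∞
  · simp [hfin]
  have hF2 : MemLp F 2 (volume : Measure ℝ) := by
    refine ⟨hF.1, ?_⟩
    rw [eLpNorm_eq_lintegral_rpow_enorm_toReal (by norm_num) (by norm_num)]
    refine ENNReal.rpow_lt_top_of_nonneg (by norm_num) ?_
    simpa using hfin
  calc ∫⁻ x, ‖𝓕 F x‖ₑ ^ 2 = ∫⁻ x, ‖𝓕 F (-x)‖ₑ ^ 2 :=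
        (lintegral_neg_eq_self (fun x ↦ ‖𝓕 F x‖ₑ ^ 2)).symm
    _ = ∫⁻ x, ‖(𝓕⁻ hF2.toLp : Lp ℂ 2 (volume : Measure ℝ)) x‖ₑ ^ 2 := by
        refine lintegral_congr_ae ?_
        filter_upwards [fourierInv_toLp_ae_eq hF hF2] with x hx
        rw [hx, Real.fourierInv_eq_fourier_neg]
    _ = ‖(hF2.toLp : Lp ℂ 2 (volume : Measure ℝ))‖ₑ ^ 2 := by
        rw [lintegral_enorm_toLp_sq]
        congr 1
        exact ((Lp.fourierTransformₗᵢ ℝ ℂ).symm.enorm_map _)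
    _ = ∫⁻ x, ‖F x‖ₑ ^ 2 := by
        rw [← lintegral_enorm_toLp_sq]
        refine lintegral_congr_ae ?_
        filter_upwards [hF2.coeFn_toLp] with x hx
        rw [hx]
    _ ≤ _ := le_rfl

/-! ### A Gagliardo–Nirenberg inequality in the half-derivative space -/

/-- The inner part of the Gagliardo seminorm of order `1/2` of a function on the line: its integral
in `x` is the square of the homogeneous `H^{1/2}` seminorm. The junk value of the quotient at
`h = 0` is immaterial. -/
noncomputable def gagliardoDensity (v : ℝ → ℝ≥0) (x : ℝ) : ℝ≥0∞ :=
  ∫⁻ h : ℝ, ‖((v (x + h) : ℝ) - v x)‖ₑ ^ 2 / ‖h‖ₑ ^ 2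

/-- By Chebyshev's inequality, `v (x + h) < v x / 2` on at least half of the interval
`0 < h < r`, where `r = 2 M (2 / v x) ^ m` and `M = ∫ v ^ m`; this bounds `gagliardoDensity v x`
from below by `v x ^ 2 / (8 r)`. -/
theorem pow_le_lintegral_pow_mul_gagliardoDensity {v : ℝ → ℝ≥0} (hv : Measurable v) (m : ℕ)
    (M : ℝ≥0) (hM0 : M ≠ 0) (hM : ∫⁻ x, (v x : ℝ≥0∞) ^ m = M) (x : ℝ) :
    (v x : ℝ≥0∞) ^ (m + 2) ≤ 2 ^ (m + 4) * M * gagliardoDensity v x := by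
  rcases eq_or_ne (v x) 0 with h0 | h0
  · simp [h0]
  set y := v x with hy
  have hypos : 0 < y := pos_iff_ne_zero.mpr h0
  have hMpos : 0 < M := pos_iff_ne_zero.mpr hM0
  set r : ℝ≥0 := 2 * M * (2 / y) ^ m with hr
  have hrpos : 0 < r := by positivity
  set ε : ℝ≥0 := (y / 2) ^ m with hε
  have hεpos : 0 < ε := by positivity
  -- `B` is the set of `h` with `v (x + h) ≥ v x / 2`.
  set B : Set ℝ := {h | (ε : ℝ≥0∞) ≤ (v (x + h) : ℝ≥0∞) ^ m} with hB
  have hmeas : Measurable fun h ↦ (v (x + h) : ℝ≥0∞) ^ m := by fun_prop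
  have hBm : MeasurableSet B := measurableSet_le measurable_const hmeas
  have hBvol : volume B ≤ ((r / 2 : ℝ≥0) : ℝ≥0∞) := by
    have h1 := mul_meas_ge_le_lintegral (μ := volume) hmeas (ε : ℝ≥0∞)
    rw [lintegral_add_left_eq_self (fun z ↦ (v z : ℝ≥0∞) ^ m) x, hM] at h1
    have h2 : ((r / 2 : ℝ≥0) : ℝ≥0∞) = (M : ℝ≥0∞) / (ε : ℝ≥0∞) := by
      rw [← ENNReal.coe_div hεpos.ne']
      congr 1
      rw [hr, hε, div_pow, div_pow]
      field_simp
    rw [h2, ENNReal.le_div_iff_mul_le (by simp [hεpos.ne']) (by simp), mul_comm]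
    exact h1
  set S : Set ℝ := Set.Ioo 0 (r : ℝ) \ B with hS
  have hSm : MeasurableSet S := measurableSet_Ioo.diff hBm
  have hSvol : ((r / 2 : ℝ≥0) : ℝ≥0∞) ≤ volume S := by
    have h1 : volume (Set.Ioo 0 (r : ℝ)) - volume B ≤ volume S := le_measure_sdiff
    have h2 : volume (Set.Ioo 0 (r : ℝ)) = ((r / 2 : ℝ≥0) : ℝ≥0∞) + ((r / 2 : ℝ≥0) : ℝ≥0∞) := by
      rw [Real.volume_Ioo, sub_zero, ENNReal.ofReal_coe_nnreal, ← ENNReal.coe_add, add_halves]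
    refine le_trans ?_ h1
    rw [h2]
    refine le_trans ?_ (tsub_le_tsub_left hBvol _)
    rw [ENNReal.add_sub_cancel_right ENNReal.coe_ne_top]
  have hlow : (((y / 2) ^ 2 / r ^ 2 : ℝ≥0) : ℝ≥0∞) * ((r / 2 : ℝ≥0) : ℝ≥0∞)
      ≤ gagliardoDensity v x := by
    calc (((y / 2) ^ 2 / r ^ 2 : ℝ≥0) : ℝ≥0∞) * ((r / 2 : ℝ≥0) : ℝ≥0∞)
        ≤ (((y / 2) ^ 2 / r ^ 2 : ℝ≥0) : ℝ≥0∞) * volume S := by gcongr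
      _ = ∫⁻ _ in S, (((y / 2) ^ 2 / r ^ 2 : ℝ≥0) : ℝ≥0∞) := by
          rw [setLIntegral_const]
      _ ≤ ∫⁻ h in S, ‖((v (x + h) : ℝ) - v x)‖ₑ ^ 2 / ‖h‖ₑ ^ 2 := by
          refine setLIntegral_mono' hSm fun h hh ↦ ?_
          have hh0 : 0 < h := hh.1.1
          have hhr : h < r := hh.1.2
          have hvlt : v (x + h) < y / 2 := by
            have h3 : ¬ ((ε : ℝ≥0∞) ≤ (v (x + h) : ℝ≥0∞) ^ m) := hh.2
            rw [not_le] at h3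
            have h4 : v (x + h) ^ m < (y / 2) ^ m := by exact_mod_cast h3
            exact lt_of_pow_lt_pow_left₀ m (by positivity) h4
          rw [ENNReal.coe_div (by positivity), ENNReal.coe_pow, ENNReal.coe_pow]
          have hvlt' : (v (x + h) : ℝ) < y / 2 := by exact_mod_cast hvlt
          gcongr
          · rw [Real.enorm_eq_ofReal_abs, ← ENNReal.ofReal_coe_nnreal]
            refine ENNReal.ofReal_le_ofReal ?_
            push_cast
            rw [abs_sub_comm]
            refine le_trans ?_ (le_abs_self _)
            linarith
          · rw [Real.enorm_eq_ofReal_abs, ← ENNReal.ofReal_coe_nnreal, abs_of_pos hh0]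
            exact ENNReal.ofReal_le_ofReal hhr.le
      _ ≤ gagliardoDensity v x := setLIntegral_le_lintegral _ _
  calc (y : ℝ≥0∞) ^ (m + 2)
      = 2 ^ (m + 4) * M * ((((y / 2) ^ 2 / r ^ 2 : ℝ≥0) : ℝ≥0∞) * ((r / 2 : ℝ≥0) : ℝ≥0∞)) := by
        have : y ^ (m + 2) = 2 ^ (m + 4) * M * ((y / 2) ^ 2 / r ^ 2 * (r / 2)) := by
          rw [hr, div_pow, div_pow]
          field_simp
          ring
        exact_mod_cast congrArg ((↑) : ℝ≥0 → ℝ≥0∞) this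
    _ ≤ _ := by gcongr

theorem lintegral_pow_add_two_le {v : ℝ → ℝ≥0} (hv : Measurable v) {m : ℕ} (hm : m ≠ 0)
    (hM : ∫⁻ x, (v x : ℝ≥0∞) ^ m ≠ ∞) :
    ∫⁻ x, (v x : ℝ≥0∞) ^ (m + 2) ≤
      2 ^ (m + 4) * (∫⁻ x, (v x : ℝ≥0∞) ^ m) * ∫⁻ x, gagliardoDensity v x := by
  lift (∫⁻ x, (v x : ℝ≥0∞) ^ m) to ℝ≥0 using hM with M hM'
  rcases eq_or_ne M 0 with rfl | h0
  · have h1 : ∫⁻ x, (v x : ℝ≥0∞) ^ m = 0 := by simpa using hM'.symm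
    rw [lintegral_eq_zero_iff (by fun_prop)] at h1
    have h2 : ∫⁻ x, (v x : ℝ≥0∞) ^ (m + 2) = 0 := by
      rw [lintegral_eq_zero_iff (by fun_prop)]
      filter_upwards [h1] with x hx
      have : v x = 0 := by simpa [hm] using hx
      simp [this]
    simp [h2]
  · rw [← lintegral_const_mul' _ _ (by finiteness)]
    exact lintegral_mono fun x ↦
      pow_le_lintegral_pow_mul_gagliardoDensity hv m M h0 hM'.symm x

/-- The Gagliardo–Nirenberg inequality `‖v‖₅⁵ ≤ C ‖v‖₁ ‖v‖⁴` with the homogeneous `H^{1/2}`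
seminorm on the right, in two steps: from `L¹` to `L³`, from `L³` to `L⁵`. -/
theorem lintegral_pow_five_le {v : ℝ → ℝ≥0} (hv : Measurable v)
    (hM : ∫⁻ x, (v x : ℝ≥0∞) ≠ ∞) :
    ∫⁻ x, (v x : ℝ≥0∞) ^ 5 ≤
      2 ^ 12 * (∫⁻ x, (v x : ℝ≥0∞)) * (∫⁻ x, gagliardoDensity v x) ^ 2 := by
  have h1 := lintegral_pow_add_two_le hv one_ne_zero (by simpa using hM)
  simp only [pow_one, Nat.reduceAdd] at h1
  by_cases h3 : ∫⁻ x, (v x : ℝ≥0∞) ^ 3 = ∞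
  · rw [h3, top_le_iff] at h1
    have hM0 : ∫⁻ x, (v x : ℝ≥0∞) ≠ 0 := by
      intro h; simp [h] at h1
    have hQ : ∫⁻ x, gagliardoDensity v x = ∞ := by
      by_contra hQ
      exact (ENNReal.mul_ne_top (ENNReal.mul_ne_top (by finiteness) hM) hQ) h1
    rw [hQ]
    simp [ENNReal.mul_top, hM0]
  · have h2 := lintegral_pow_add_two_le hv (m := 3) (by norm_num) h3
    simp only [Nat.reduceAdd] at h2
    calc _ ≤ _ := h2
      _ ≤ 2 ^ 7 * (2 ^ 5 * (∫⁻ x, (v x : ℝ≥0∞)) * ∫⁻ x, gagliardoDensity v x)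
            * ∫⁻ x, gagliardoDensity v x := by gcongr
      _ = _ := by ring

/-! ### The Gagliardo seminorm on the Fourier side -/

/-- The constant `∫ |exp (-2πiy) - 1|² / y² dy` relating the Gagliardo seminorm of order `1/2` to
the weight `|p|` on the Fourier side. -/
noncomputable def gagliardoConst : ℝ≥0∞ :=
  ∫⁻ y : ℝ, ‖Complex.exp (-2 * Real.pi * y * Complex.I) - 1‖ₑ ^ 2 / ‖y‖ₑ ^ 2

theorem gagliardoConst_ne_top : gagliardoConst ≠ ∞ := by
  have hint : Integrable fun y : ℝ ↦ (4 + 4 * Real.pi ^ 2) * (1 + y ^ 2)⁻¹ :=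
    integrable_inv_one_add_sq.const_mul _
  refine ne_top_of_le_ne_top hint.lintegral_lt_top.ne (lintegral_mono_ae ?_)
  filter_upwards [Measure.ae_ne volume (0 : ℝ)] with y hy
  set z : ℂ := Complex.exp (-2 * Real.pi * y * Complex.I) - 1 with hz
  have hz1 : ‖z‖ ≤ 2 := by
    have : ‖Complex.exp (-2 * Real.pi * y * Complex.I)‖ = 1 := by
      rw [Complex.norm_exp]; simp
    calc ‖z‖ ≤ _ := norm_sub_le _ _
      _ ≤ 2 := by rw [this, norm_one]; norm_num
  have hz2 : ‖z‖ ≤ 2 * Real.pi * |y| := by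
    have := Real.norm_exp_I_mul_ofReal_sub_one_le (x := -2 * Real.pi * y)
    rw [Real.norm_eq_abs, abs_mul, abs_mul, abs_of_pos Real.pi_pos] at this
    norm_num at this
    convert this using 3
    ring_nf
  have hy2 : 0 < y ^ 2 := by positivity
  have hq : ‖z‖ ^ 2 / y ^ 2 ≤ (4 + 4 * Real.pi ^ 2) * (1 + y ^ 2)⁻¹ := by
    rw [← div_eq_mul_inv, div_le_div_iff₀ hy2 (by positivity)]
    have h1 : ‖z‖ ^ 2 ≤ 4 := by nlinarith [norm_nonneg z]
    have h2 : ‖z‖ ^ 2 ≤ 4 * Real.pi ^ 2 * y ^ 2 := by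
      calc ‖z‖ ^ 2 ≤ (2 * Real.pi * |y|) ^ 2 := by gcongr
        _ = _ := by rw [mul_pow, sq_abs]; ring
    nlinarith
  calc ‖z‖ₑ ^ 2 / ‖y‖ₑ ^ 2 = ENNReal.ofReal (‖z‖ ^ 2 / y ^ 2) := by
        rw [ENNReal.ofReal_div_of_pos hy2, ← sq_abs y, ENNReal.ofReal_pow (norm_nonneg _),
          ENNReal.ofReal_pow (abs_nonneg _), ofReal_norm, ← Real.norm_eq_abs, ofReal_norm]
    _ ≤ _ := ENNReal.ofReal_le_ofReal hq

theorem lintegral_exp_sub_one_sq_div_sq (p : ℝ) :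
    ∫⁻ h : ℝ, ‖Complex.exp (-2 * Real.pi * (p * h : ℝ) * Complex.I) - 1‖ₑ ^ 2 / ‖h‖ₑ ^ 2
      = gagliardoConst * ‖p‖ₑ := by
  rcases eq_or_ne p 0 with rfl | hp
  · simp
  set φ : ℝ → ℝ≥0∞ := fun y ↦ ‖Complex.exp (-2 * Real.pi * y * Complex.I) - 1‖ₑ ^ 2 / ‖y‖ₑ ^ 2
  have hφ : Measurable φ := by fun_prop
  have hp' : ‖p‖ₑ ≠ 0 := by simpa using hp
  have h1 : ∫⁻ h : ℝ, φ (p * h) = ‖p‖ₑ⁻¹ * gagliardoConst := by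
    have h2 := lintegral_map (μ := (volume : Measure ℝ)) hφ (measurable_const_mul p)
    rw [Real.map_volume_mul_left hp, lintegral_smul_measure] at h2
    rw [← h2, abs_inv, ENNReal.ofReal_inv_of_pos (abs_pos.mpr hp), ← Real.norm_eq_abs,
      ofReal_norm]
    rfl
  have h3 : ∀ h : ℝ, ‖Complex.exp (-2 * Real.pi * (p * h : ℝ) * Complex.I) - 1‖ₑ ^ 2 / ‖h‖ₑ ^ 2
      = ‖p‖ₑ ^ 2 * φ (p * h) := by
    intro h
    simp only [φ, enorm_mul, mul_pow, div_eq_mul_inv]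
    rw [ENNReal.mul_inv (by left; simpa using hp) (by left; finiteness)]
    calc _ = (‖p‖ₑ ^ 2 * (‖p‖ₑ ^ 2)⁻¹) *
          (‖Complex.exp (-2 * Real.pi * (p * h : ℝ) * Complex.I) - 1‖ₑ ^ 2 * (‖h‖ₑ ^ 2)⁻¹) := by
          rw [ENNReal.mul_inv_cancel (by simpa using hp) (by finiteness), one_mul]
      _ = _ := by ring
  simp_rw [h3]
  rw [lintegral_const_mul' _ _ (by finiteness), h1, sq, mul_assoc, ← mul_assoc ‖p‖ₑ ‖p‖ₑ⁻¹,
    ENNReal.mul_inv_cancel hp' (by finiteness), one_mul, mul_comm]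

/-- If `v` is the Fourier transform of an integrable function `C`, its Gagliardo seminorm of order
`1/2` is controlled by `∫ |p| |C p|² dp`: apply Plancherel to each difference
`v (· + h) - v`. -/
theorem lintegral_gagliardoDensity_le {v : ℝ → ℝ≥0} {C : ℝ → ℂ} (hC : Integrable C)
    (hv : ∀ x, ((v x : ℝ) : ℂ) = 𝓕 C x) :
    ∫⁻ x, gagliardoDensity v x ≤ gagliardoConst * ∫⁻ p, ‖p‖ₑ * ‖C p‖ₑ ^ 2 := by
  have hvm : Measurable v := by
    have h1 : Continuous fun x ↦ ((v x : ℝ) : ℂ) := by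
      simpa only [hv] using Real.continuous_fourier_of_integrable hC
    have h2 : Continuous fun x ↦ (v x : ℝ) := by
      simpa [Function.comp_def] using Complex.continuous_re.comp h1
    exact measurable_coe_nnreal_real_iff.mp h2.measurable
  have hshift : ∀ h x : ℝ, 𝓕 (fun p : ℝ ↦
      (Complex.exp (-2 * Real.pi * (p * h : ℝ) * Complex.I) - 1) * C p) x
        = ((v (x + h) : ℝ) : ℂ) - ((v x : ℝ) : ℂ) := by
    intro h x
    have hi : ∀ z, Integrable fun p : ℝ ↦
        Complex.exp (↑(-2 * Real.pi * p * z) * Complex.I) • C p := by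
      intro z
      simp only [smul_eq_mul]
      refine hC.bdd_mul (c := 1) (by fun_prop) (Eventually.of_forall fun p ↦ ?_)
      rw [Complex.norm_exp_ofReal_mul_I]
    rw [hv, hv, Real.fourier_real_eq_integral_exp_smul, Real.fourier_real_eq_integral_exp_smul,
      Real.fourier_real_eq_integral_exp_smul, ← integral_sub (hi _) (hi _)]
    refine integral_congr_ae (Eventually.of_forall fun p ↦ ?_)
    simp only [smul_eq_mul]
    rw [sub_mul, mul_sub, one_mul, ← mul_assoc, ← Complex.exp_add]
    congr 3
    push_cast; ring_nf
  have hint : ∀ h : ℝ, Integrable fun p : ℝ ↦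
      (Complex.exp (-2 * Real.pi * (p * h : ℝ) * Complex.I) - 1) * C p := by
    intro h
    refine hC.bdd_mul (c := 2) (by fun_prop) (Eventually.of_forall fun p ↦ ?_)
    refine (norm_sub_le _ _).trans ?_
    have : ‖Complex.exp (-2 * Real.pi * (p * h : ℝ) * Complex.I)‖ = 1 := by
      rw [Complex.norm_exp]; simp
    rw [this, norm_one]; norm_num
  unfold gagliardoDensity
  -- Integrate in `x` first, for fixed `h`; on the Fourier side, integrate in `h` first.
  rw [lintegral_lintegral_swap (by fun_prop)]
  calc ∫⁻ h : ℝ, ∫⁻ x : ℝ, ‖((v (x + h) : ℝ) - v x)‖ₑ ^ 2 / ‖h‖ₑ ^ 2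
      = ∫⁻ h : ℝ, (∫⁻ x : ℝ, ‖((v (x + h) : ℝ) - v x)‖ₑ ^ 2) / ‖h‖ₑ ^ 2 := by
        simp only [div_eq_mul_inv]
        refine lintegral_congr fun h ↦ ?_
        rw [lintegral_mul_const _ (by fun_prop)]
    _ ≤ ∫⁻ h : ℝ, (∫⁻ p : ℝ,
          ‖(Complex.exp (-2 * Real.pi * (p * h : ℝ) * Complex.I) - 1) * C p‖ₑ ^ 2) / ‖h‖ₑ ^ 2 := by
        refine lintegral_mono fun h ↦ ?_
        refine ENNReal.div_le_div_right
          (le_trans (le_of_eq ?_) (lintegral_fourier_sq_le (hint h))) _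
        refine lintegral_congr fun x ↦ ?_
        rw [hshift, ← Complex.ofReal_sub, ← ofReal_norm, ← ofReal_norm,
          Complex.norm_real]
    _ = ∫⁻ h : ℝ, ∫⁻ p : ℝ, ‖Complex.exp (-2 * Real.pi * (p * h : ℝ) * Complex.I) - 1‖ₑ ^ 2
          / ‖h‖ₑ ^ 2 * ‖C p‖ₑ ^ 2 := by
        refine lintegral_congr fun h ↦ ?_
        simp only [div_eq_mul_inv]
        rw [mul_comm, ← lintegral_const_mul'' _
          (((hint h).1.enorm).pow_const 2)]
        refine lintegral_congr fun p ↦ ?_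
        rw [enorm_mul, mul_pow]; ring
    _ = ∫⁻ p : ℝ, ∫⁻ h : ℝ, ‖Complex.exp (-2 * Real.pi * (p * h : ℝ) * Complex.I) - 1‖ₑ ^ 2
          / ‖h‖ₑ ^ 2 * ‖C p‖ₑ ^ 2 := by
        refine lintegral_lintegral_swap ?_
        refine AEMeasurable.mul (by fun_prop) ?_
        exact (hC.1.enorm.pow_const 2).comp_snd
    _ = ∫⁻ p : ℝ, gagliardoConst * ‖p‖ₑ * ‖C p‖ₑ ^ 2 := by
        refine lintegral_congr fun p ↦ ?_
        rw [lintegral_mul_const' _ _ (by finiteness), lintegral_exp_sub_one_sq_div_sq]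
    _ = _ := by
        rw [← lintegral_const_mul' _ _ gagliardoConst_ne_top]
        simp only [mul_assoc]

/-! ### Autocorrelation -/

/-- The autocorrelation of `G`, whose Fourier transform is `|𝓕 G|²`. -/
noncomputable def autocorrelation (G : ℝ → ℂ) (p : ℝ) : ℂ :=
  ∫ t, G t * starRingEnd ℂ (G (t - p))

theorem autocorrelation_eq_convolution (G : ℝ → ℂ) :
    autocorrelation G = convolution G (fun y ↦ starRingEnd ℂ (G (-y)))
      (ContinuousLinearMap.mul ℂ ℂ) volume := by
  ext p
  simp [autocorrelation, convolution]

theorem integrable_star_comp_neg {G : ℝ → ℂ} (hG : Integrable G) :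
    Integrable fun y ↦ starRingEnd ℂ (G (-y)) :=
  (Complex.conjLIE.toContinuousLinearEquiv.toContinuousLinearMap.integrable_comp hG.comp_neg)

theorem integrable_autocorrelation {G : ℝ → ℂ} (hG : Integrable G) :
    Integrable (autocorrelation G) := by
  rw [autocorrelation_eq_convolution]
  exact hG.integrable_convolution _ (integrable_star_comp_neg hG)

theorem fourier_autocorrelation {G : ℝ → ℂ} (hG : Integrable G) (x : ℝ) :
    𝓕 (autocorrelation G) x = (((‖𝓕 G x‖₊ ^ 2 : ℝ≥0) : ℝ) : ℂ) := by
  have h : 𝓕 (fun y ↦ starRingEnd ℂ (G (-y))) x = starRingEnd ℂ (𝓕 G x) := by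
    rw [Real.fourier_real_eq_integral_exp_smul, Real.fourier_real_eq_integral_exp_smul,
      ← integral_conj, ← integral_neg_eq_self]
    refine integral_congr_ae (Eventually.of_forall fun y ↦ ?_)
    simp only [smul_eq_mul, map_mul, ← Complex.exp_conj, neg_neg]
    congr 2
    simp [Complex.conj_ofNat]
  rw [autocorrelation_eq_convolution,
    Real.fourier_mul_convolution_eq hG (integrable_star_comp_neg hG), h, Complex.mul_conj]
  simp [Complex.normSq_eq_norm_sq]

/-! ### The Strichartz estimate for Schwartz data -/

theorem continuous_schrodingerSymbol_uncurry :
    Continuous fun z : ℝ × ℝ ↦ schrodingerSymbol z.1 z.2 := by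
  unfold schrodingerSymbol
  fun_prop

theorem integrable_schrodingerSymbol_mul (a : ℝ) {g : ℝ → ℂ} (hg : Integrable g) :
    Integrable fun ξ ↦ schrodingerSymbol a ξ * g ξ := by
  refine hg.bdd_mul (c := 1) ?_ (Eventually.of_forall fun ξ ↦ (norm_schrodingerSymbol a ξ).le)
  exact (continuous_schrodingerSymbol_uncurry.comp (by fun_prop : Continuous fun ξ : ℝ ↦ (a, ξ)))
    |>.aestronglyMeasurable

/-- The difference of two squares is affine, so that the autocorrelation of the free evolution at
`p`, as a function of the time `a`, is a Fourier transform at the frequency `4πpa`. -/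
theorem enorm_autocorrelation_schrodingerSymbol_mul (a p : ℝ) (g : ℝ → ℂ) :
    ‖autocorrelation (fun ξ ↦ schrodingerSymbol a ξ * g ξ) p‖ₑ =
      ‖𝓕 (fun t ↦ g t * starRingEnd ℂ (g (t - p))) (4 * Real.pi * p * a)‖ₑ := by
  have h : autocorrelation (fun ξ ↦ schrodingerSymbol a ξ * g ξ) p =
      Complex.exp ((4 * Real.pi ^ 2 * p ^ 2 * a : ℝ) * Complex.I) *
        𝓕 (fun t ↦ g t * starRingEnd ℂ (g (t - p))) (4 * Real.pi * p * a) := by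
    rw [autocorrelation, Real.fourier_real_eq_integral_exp_smul, ← integral_const_mul]
    refine integral_congr_ae (Eventually.of_forall fun t ↦ ?_)
    simp only [schrodingerSymbol, smul_eq_mul, map_mul, ← Complex.exp_conj]
    rw [mul_mul_mul_comm, ← Complex.exp_add]
    conv_rhs => rw [← mul_assoc, ← Complex.exp_add]
    congr 2
    simp only [map_neg, map_mul, Complex.conj_I, Complex.conj_ofReal]
    push_cast
    ring
  rw [h, enorm_mul, ← ofReal_norm (Complex.exp _), Complex.norm_exp_ofReal_mul_I]
  simp

/-- Plancherel in the time variable, for the autocorrelation of the free evolution. -/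
theorem lintegral_autocorrelation_schrodingerSymbol_mul_le {p : ℝ} (hp : p ≠ 0) {g : ℝ → ℂ}
    (hg : MemLp g 2 (volume : Measure ℝ)) :
    ∫⁻ a, ‖p‖ₑ * ‖autocorrelation (fun ξ ↦ schrodingerSymbol a ξ * g ξ) p‖ₑ ^ 2 ≤
      ∫⁻ t, ‖g t‖ₑ ^ 2 * ‖g (t - p)‖ₑ ^ 2 := by
  set k : ℝ → ℂ := fun t ↦ g t * starRingEnd ℂ (g (t - p)) with hk
  have hgp : MemLp (fun t ↦ starRingEnd ℂ (g (t - p))) 2 (volume : Measure ℝ) := by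
    have h1 : MemLp (fun t ↦ g (t - p)) 2 (volume : Measure ℝ) :=
      hg.comp_measurePreserving (measurePreserving_sub_right volume p)
    exact h1.star
  have hki : Integrable k := hg.integrable_mul hgp
  have hc : 4 * Real.pi * p ≠ 0 := by positivity
  have hφ : Measurable fun y ↦ ‖𝓕 k y‖ₑ ^ 2 :=
    ((Real.continuous_fourier_of_integrable hki).enorm.measurable.pow_const 2)
  have hscale := lintegral_map (μ := (volume : Measure ℝ)) hφ
    (measurable_const_mul (4 * Real.pi * p))
  rw [Real.map_volume_mul_left hc, lintegral_smul_measure] at hscale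
  have hconst : ‖p‖ₑ * ENNReal.ofReal |(4 * Real.pi * p)⁻¹| ≤ 1 := by
    rw [← ofReal_norm, ← ENNReal.ofReal_mul (norm_nonneg _), ENNReal.ofReal_le_one,
      Real.norm_eq_abs,
      ← abs_mul]
    have : p * (4 * Real.pi * p)⁻¹ = (4 * Real.pi)⁻¹ := by field_simp
    rw [this, abs_of_pos (by positivity)]
    refine inv_le_one_of_one_le₀ ?_
    nlinarith [Real.pi_gt_three]
  calc ∫⁻ a, ‖p‖ₑ * ‖autocorrelation (fun ξ ↦ schrodingerSymbol a ξ * g ξ) p‖ₑ ^ 2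
      = ‖p‖ₑ * ∫⁻ a, ‖𝓕 k (4 * Real.pi * p * a)‖ₑ ^ 2 := by
        simp_rw [enorm_autocorrelation_schrodingerSymbol_mul]
        rw [lintegral_const_mul' _ _ (by finiteness)]
    _ = (‖p‖ₑ * ENNReal.ofReal |(4 * Real.pi * p)⁻¹|) * ∫⁻ y, ‖𝓕 k y‖ₑ ^ 2 := by
        rw [← hscale, smul_eq_mul, ← mul_assoc ‖p‖ₑ]
    _ ≤ 1 * ∫⁻ y, ‖k y‖ₑ ^ 2 := by
        exact mul_le_mul' hconst (lintegral_fourier_sq_le hki)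
    _ = _ := by
        rw [one_mul]
        refine lintegral_congr fun t ↦ ?_
        rw [hk]
        simp only [enorm_mul, mul_pow]
        congr 2
        rw [← ofReal_norm, ← ofReal_norm, RCLike.norm_conj]

/-- The bilinear space-time estimate `∫ ‖|u(a)|²‖² da ≤ C ‖u(0)‖⁴` in the homogeneous `H^{1/2}`
seminorm, for the free evolution with initial datum of Fourier transform `g`. -/
theorem lintegral_gagliardoDensity_schrodinger_le {g : ℝ → ℂ} (hgc : Continuous g)
    (hgi : Integrable g) (hg : MemLp g 2 (volume : Measure ℝ)) :
    ∫⁻ a, ∫⁻ x, gagliardoDensity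
        (fun x ↦ ‖𝓕 (fun ξ ↦ schrodingerSymbol a ξ * g ξ) x‖₊ ^ 2) x ≤
      gagliardoConst * (∫⁻ ξ, ‖g ξ‖ₑ ^ 2) ^ 2 := by
  have hmeas : Measurable fun z : ℝ × ℝ ↦
      autocorrelation (fun ξ ↦ schrodingerSymbol z.1 ξ * g ξ) z.2 := by
    have hc : Continuous fun w : (ℝ × ℝ) × ℝ ↦
        (schrodingerSymbol w.1.1 w.2 * g w.2) *
          starRingEnd ℂ (schrodingerSymbol w.1.1 (w.2 - w.1.2) * g (w.2 - w.1.2)) := by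
      unfold schrodingerSymbol
      fun_prop
    exact hc.stronglyMeasurable.integral_prod_right.measurable
  calc _ ≤ ∫⁻ a, gagliardoConst * ∫⁻ p, ‖p‖ₑ *
          ‖autocorrelation (fun ξ ↦ schrodingerSymbol a ξ * g ξ) p‖ₑ ^ 2 := by
        refine lintegral_mono fun a ↦ ?_
        have hi := integrable_schrodingerSymbol_mul a hgi
        exact lintegral_gagliardoDensity_le (integrable_autocorrelation hi)
          fun x ↦ (fourier_autocorrelation hi x).symm
    _ = gagliardoConst * ∫⁻ a, ∫⁻ p, ‖p‖ₑ *
          ‖autocorrelation (fun ξ ↦ schrodingerSymbol a ξ * g ξ) p‖ₑ ^ 2 :=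
        lintegral_const_mul' _ _ gagliardoConst_ne_top
    _ = gagliardoConst * ∫⁻ p, ∫⁻ a, ‖p‖ₑ *
          ‖autocorrelation (fun ξ ↦ schrodingerSymbol a ξ * g ξ) p‖ₑ ^ 2 := by
        rw [lintegral_lintegral_swap]
        exact ((measurable_snd.enorm).mul (hmeas.enorm.pow_const 2)).aemeasurable
    _ ≤ gagliardoConst * ∫⁻ p : ℝ, ∫⁻ t, ‖g t‖ₑ ^ 2 * ‖g (t - p)‖ₑ ^ 2 := by
        refine mul_le_mul_right (lintegral_mono_ae ?_) _
        filter_upwards [Measure.ae_ne volume (0 : ℝ)] with p hp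
        exact lintegral_autocorrelation_schrodingerSymbol_mul_le hp hg
    _ = gagliardoConst * ∫⁻ t, ∫⁻ p : ℝ, ‖g t‖ₑ ^ 2 * ‖g (t - p)‖ₑ ^ 2 := by
        rw [lintegral_lintegral_swap]
        exact (by fun_prop : Measurable (Function.uncurry fun (p t : ℝ) ↦
          ‖g t‖ₑ ^ 2 * ‖g (t - p)‖ₑ ^ 2)).aemeasurable
    _ = gagliardoConst * ∫⁻ t, ‖g t‖ₑ ^ 2 * ∫⁻ ξ, ‖g ξ‖ₑ ^ 2 := by
        congr 1
        refine lintegral_congr fun t ↦ ?_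
        rw [lintegral_const_mul' _ _ (by finiteness),
          lintegral_sub_left_eq_self (fun ξ ↦ ‖g ξ‖ₑ ^ 2) t]
    _ = _ := by
        rw [lintegral_mul_const _ (by fun_prop), sq]

theorem schrodingerGroup_ae_eq_fourierInv (a : ℝ) (f : SchwartzMap ℝ ℂ) :
    (schrodingerGroup a (f.toLp 2) : ℝ → ℂ) =ᵐ[volume]
      𝓕⁻ (fun ξ ↦ schrodingerSymbol a ξ * (𝓕 f : SchwartzMap ℝ ℂ) ξ) := by
  have hae : (fun ξ ↦ schrodingerSymbol a ξ *
        ((𝓕 (f.toLp 2 volume) : Lp ℂ 2 (volume : Measure ℝ)) : ℝ → ℂ) ξ)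
      =ᵐ[volume] fun ξ ↦ schrodingerSymbol a ξ * (𝓕 f : SchwartzMap ℝ ℂ) ξ := by
    rw [SchwartzMap.toLp_fourier_eq]
    filter_upwards [(𝓕 f).coeFn_toLp 2 (volume : Measure ℝ)] with ξ h
    rw [h]
  have hi := (integrable_schrodingerSymbol_mul a (𝓕 f).integrable).congr hae.symm
  refine (fourierInv_toLp_ae_eq hi
    (memLp_schrodingerSymbol_mul a (𝓕 (f.toLp 2 (volume : Measure ℝ))))).trans ?_
  exact Eventually.of_forall fun x ↦ Real.fourierInv_congr_ae hae x

theorem enorm_toLp_fourier (f : SchwartzMap ℝ ℂ) :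
    ∫⁻ ξ, ‖(𝓕 f) ξ‖ₑ ^ 2 = ‖f.toLp 2 (volume : Measure ℝ)‖ₑ ^ 2 := by
  rw [← (Lp.fourierTransformₗᵢ ℝ ℂ).enorm_map (f.toLp 2 (volume : Measure ℝ)),
    ← lintegral_enorm_toLp_sq]
  refine lintegral_congr_ae ?_
  change _ =ᵐ[volume] fun x ↦ ‖((𝓕 (f.toLp 2 volume) : Lp ℂ 2 (volume : Measure ℝ)) : ℝ → ℂ) x‖ₑ ^ 2
  rw [SchwartzMap.toLp_fourier_eq]
  filter_upwards [(𝓕 f).coeFn_toLp 2 (volume : Measure ℝ)] with ξ h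
  rw [h]

/-- The Strichartz estimate `L²(ℝ) → L⁵(ℝ; L¹⁰(ℝ))` for Schwartz data. -/
theorem strichartz_schwartz (f : SchwartzMap ℝ ℂ) :
    ∫⁻ a, eLpNorm (schrodingerGroup a (f.toLp 2)) 10 volume ^ 5 ≤
      2 ^ 6 * gagliardoConst * ‖f.toLp 2 (volume : Measure ℝ)‖ₑ ^ 5 := by
  set g : ℝ → ℂ := ((𝓕 f : SchwartzMap ℝ ℂ) : ℝ → ℂ) with hg
  set B : ℝ≥0∞ := ‖f.toLp 2 (volume : Measure ℝ)‖ₑ with hB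
  have hgB : ∫⁻ ξ, ‖g ξ‖ₑ ^ 2 = B ^ 2 := enorm_toLp_fourier f
  set v : ℝ → ℝ → ℝ≥0 := fun a x ↦ ‖𝓕 (fun ξ ↦ schrodingerSymbol a ξ * g ξ) x‖₊ ^ 2 with hv
  have hpt : ∀ a, eLpNorm (schrodingerGroup a (f.toLp 2)) 10 volume ^ 5 ≤
      2 ^ 6 * B * ∫⁻ x, gagliardoDensity (v a) x := by
    intro a
    have hi := integrable_schrodingerSymbol_mul a (𝓕 f).integrable
    have hvm : Measurable (v a) :=
      (Real.continuous_fourier_of_integrable hi).nnnorm.measurable.pow_const 2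
    have hv1 : ∫⁻ x, (v a x : ℝ≥0∞) ≤ B ^ 2 := by
      calc ∫⁻ x, (v a x : ℝ≥0∞) ≤ ∫⁻ ξ, ‖schrodingerSymbol a ξ * g ξ‖ₑ ^ 2 := by
            simpa [hv, enorm] using lintegral_fourier_sq_le hi
        _ = B ^ 2 := by
            rw [← hgB]
            refine lintegral_congr fun ξ ↦ ?_
            rw [enorm_mul, ← ofReal_norm (schrodingerSymbol a ξ), norm_schrodingerSymbol]
            simp
    have h10 : eLpNorm (schrodingerGroup a (f.toLp 2)) 10 volume ^ 10 =
        ∫⁻ x, (v a x : ℝ≥0∞) ^ 5 := by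
      rw [eLpNorm_congr_ae (schrodingerGroup_ae_eq_fourierInv a f),
        eLpNorm_eq_lintegral_rpow_enorm_toReal (by norm_num) (by norm_num),
        ← ENNReal.rpow_natCast, ← ENNReal.rpow_mul]
      norm_num
      rw [← lintegral_neg_eq_self]
      refine lintegral_congr fun x ↦ ?_
      rw [Real.fourierInv_eq_fourier_neg, neg_neg, hv]
      simp only [ENNReal.coe_pow, ← pow_mul]
      rfl
    -- `‖u‖₁₀¹⁰ = ‖v‖₅⁵` with `v = |u|²`, and `‖v‖₁ = ‖u‖₂² ≤ B²`.
    have hsq : (eLpNorm (schrodingerGroup a (f.toLp 2)) 10 volume ^ 5) ^ 2 ≤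
        (2 ^ 6 * B * ∫⁻ x, gagliardoDensity (v a) x) ^ 2 := by
      rw [← pow_mul, h10]
      refine (lintegral_pow_five_le hvm (ne_top_of_le_ne_top (by finiteness) hv1)).trans ?_
      calc _ ≤ 2 ^ 12 * B ^ 2 * (∫⁻ x, gagliardoDensity (v a) x) ^ 2 := by gcongr
        _ = _ := by ring
    exact (ENNReal.pow_le_pow_left_iff two_ne_zero).mp hsq
  calc _ ≤ ∫⁻ a, 2 ^ 6 * B * ∫⁻ x, gagliardoDensity (v a) x := lintegral_mono hpt
    _ = 2 ^ 6 * B * ∫⁻ a, ∫⁻ x, gagliardoDensity (v a) x :=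
        lintegral_const_mul' _ _ (by finiteness)
    _ ≤ 2 ^ 6 * B * (gagliardoConst * (B ^ 2) ^ 2) := by
        gcongr
        rw [← hgB]
        exact lintegral_gagliardoDensity_schrodinger_le (𝓕 f).continuous (𝓕 f).integrable
          ((𝓕 f).memLp 2 volume)
    _ = _ := by ring

/-! ### Extension to square-integrable data -/

/-- Multiplication by the Schrödinger symbol on `L²`. -/
noncomputable def symbolMul (a : ℝ) (h : Lp ℂ 2 (volume : Measure ℝ)) :
    Lp ℂ 2 (volume : Measure ℝ) :=
  (memLp_schrodingerSymbol_mul a h).toLp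

theorem schrodingerGroup_eq (a : ℝ) (f : Lp ℂ 2 (volume : Measure ℝ)) :
    schrodingerGroup a f = (Lp.fourierTransformₗᵢ ℝ ℂ).symm
      (symbolMul a (Lp.fourierTransformₗᵢ ℝ ℂ f)) := rfl

theorem isometry_symbolMul (a : ℝ) : Isometry (symbolMul a) := by
  intro h k
  rw [Lp.edist_def, Lp.edist_def]
  refine eLpNorm_congr_norm_ae ?_
  filter_upwards [(memLp_schrodingerSymbol_mul a h).coeFn_toLp,
    (memLp_schrodingerSymbol_mul a k).coeFn_toLp] with ξ h1 h2
  simp only [symbolMul, Pi.sub_apply, h1, h2]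
  rw [← mul_sub, norm_mul, norm_schrodingerSymbol, one_mul]

theorem isometry_schrodingerGroup (a : ℝ) : Isometry (schrodingerGroup a) :=
  (Lp.fourierTransformₗᵢ ℝ ℂ).symm.isometry.comp
    ((isometry_symbolMul a).comp (Lp.fourierTransformₗᵢ ℝ ℂ).isometry)

theorem continuous_symbolMul (h : Lp ℂ 2 (volume : Measure ℝ)) :
    Continuous fun a ↦ symbolMul a h := by
  refine continuous_iff_continuousAt.mpr fun a₀ ↦ ?_
  have hlim : Tendsto (fun a ↦ ∫⁻ ξ, ‖(schrodingerSymbol a ξ - schrodingerSymbol a₀ ξ) * h ξ‖ₑ ^ 2)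
      (nhds a₀) (nhds (∫⁻ _ : ℝ, 0)) := by
    refine tendsto_lintegral_filter_of_dominated_convergence (fun ξ ↦ (2 * ‖h ξ‖ₑ) ^ 2) ?_ ?_ ?_ ?_
    · refine Eventually.of_forall fun a ↦ ?_
      have hc : Continuous fun ξ ↦ schrodingerSymbol a ξ - schrodingerSymbol a₀ ξ := by
        unfold schrodingerSymbol; fun_prop
      exact (hc.measurable.mul (Lp.stronglyMeasurable h).measurable).enorm.pow_const 2
    · refine Eventually.of_forall fun a ↦ Eventually.of_forall fun ξ ↦ ?_
      rw [enorm_mul]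
      gcongr
      rw [← ofReal_norm]
      refine ENNReal.ofReal_le_of_le_toReal ?_
      refine (norm_sub_le _ _).trans ?_
      rw [norm_schrodingerSymbol, norm_schrodingerSymbol]
      norm_num
    · simp_rw [mul_pow]
      rw [lintegral_const_mul' _ _ (by finiteness), lintegral_enorm_toLp_sq]
      finiteness
    · refine Eventually.of_forall fun ξ ↦ ?_
      have hc : Continuous fun a ↦
          ‖(schrodingerSymbol a ξ - schrodingerSymbol a₀ ξ) * h ξ‖ₑ ^ 2 := by
        unfold schrodingerSymbol
        exact (ENNReal.continuous_pow 2).comp (by fun_prop)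
      simpa using hc.tendsto a₀
  have hval : ∀ a, ∫⁻ ξ, ‖(schrodingerSymbol a ξ - schrodingerSymbol a₀ ξ) * h ξ‖ₑ ^ 2 =
      edist (symbolMul a h) (symbolMul a₀ h) ^ 2 := by
    intro a
    rw [edist_eq_enorm_sub, ← lintegral_enorm_toLp_sq]
    refine lintegral_congr_ae ?_
    filter_upwards [(memLp_schrodingerSymbol_mul a h).coeFn_toLp,
      (memLp_schrodingerSymbol_mul a₀ h).coeFn_toLp,
      Lp.coeFn_sub (symbolMul a h) (symbolMul a₀ h)] with ξ h1 h2 h3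
    rw [h3, Pi.sub_apply, symbolMul, symbolMul, h1, h2, sub_mul]
  simp only [hval, lintegral_zero] at hlim
  refine tendsto_iff_edist_tendsto_0.mpr ?_
  have h2 := (ENNReal.continuous_rpow_const (y := (1 / 2 : ℝ))).tendsto 0 |>.comp hlim
  refine (h2.congr fun a ↦ ?_).trans (by simp)
  simp only [Function.comp_apply]
  rw [← ENNReal.rpow_natCast, ← ENNReal.rpow_mul]
  norm_num

theorem continuous_schrodingerGroup :
    Continuous fun z : ℝ × Lp ℂ 2 (volume : Measure ℝ) ↦ schrodingerGroup z.1 z.2 := by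
  refine continuous_prod_of_continuous_lipschitzWith' _ 1
    (fun a ↦ (isometry_schrodingerGroup a).lipschitz) (fun f ↦ ?_)
  exact (Lp.fourierTransformₗᵢ ℝ ℂ).symm.continuous.comp
    (continuous_symbolMul (Lp.fourierTransformₗᵢ ℝ ℂ f))

/-- Convergence in `L^p` implies almost everywhere convergence of a subsequence, whence Fatou's
lemma gives the lower semicontinuity of any other Lebesgue norm. -/
theorem lowerSemicontinuous_eLpNorm_sub {α E : Type*} {mα : MeasurableSpace α} {μ : Measure α}
    [NormedAddCommGroup E] {p : ℝ≥0∞} [Fact (1 ≤ p)] (q : ℝ≥0∞) {w : α → E}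
    (hw : AEStronglyMeasurable w μ) :
    LowerSemicontinuous fun f : Lp E p μ ↦ eLpNorm (fun x ↦ f x - w x) q μ := by
  rw [lowerSemicontinuous_iff_isClosed_preimage]
  intro C
  refine IsSeqClosed.isClosed fun F f hF hf ↦ ?_
  have hp : p ≠ 0 := (zero_lt_one.trans_le (Fact.out : 1 ≤ p)).ne'
  obtain ⟨ns, -, hns⟩ := (tendstoInMeasure_of_tendsto_Lp hf).exists_seq_tendsto_ae
  refine Lp.eLpNorm_le_of_ae_tendsto (u := atTop) (f := fun n x ↦ F (ns n) x - w x)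
    (Eventually.of_forall fun n ↦ hF (ns n)) (fun n ↦ (Lp.aestronglyMeasurable _).sub hw) ?_
  filter_upwards [hns] with x hx
  exact hx.sub_const _

theorem lowerSemicontinuous_eLpNorm {α E : Type*} {mα : MeasurableSpace α} {μ : Measure α}
    [NormedAddCommGroup E] {p : ℝ≥0∞} [Fact (1 ≤ p)] (q : ℝ≥0∞) :
    LowerSemicontinuous fun f : Lp E p μ ↦ eLpNorm f q μ := by
  simpa using lowerSemicontinuous_eLpNorm_sub (E := E) (μ := μ) (p := p) q
    (w := fun _ ↦ 0) aestronglyMeasurable_const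

theorem lowerSemicontinuous_eLpNorm_schrodingerGroup_pow :
    LowerSemicontinuous fun z : ℝ × Lp ℂ 2 (volume : Measure ℝ) ↦
      eLpNorm (schrodingerGroup z.1 z.2) 10 volume ^ 5 :=
  (ENNReal.continuous_pow 5).comp_lowerSemicontinuous
    ((lowerSemicontinuous_eLpNorm 10).comp continuous_schrodingerGroup)
    (fun _ _ h ↦ pow_le_pow_left' h 5)

/-- The Strichartz estimate `‖exp (i a Δ) f‖_{L⁵(ℝ; L¹⁰(ℝ))} ≤ C ‖f‖_{L²(ℝ)}`, raised to the fifth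
power. -/
theorem strichartz (f : Lp ℂ 2 (volume : Measure ℝ)) :
    ∫⁻ a, eLpNorm (schrodingerGroup a f) 10 volume ^ 5 ≤ 2 ^ 6 * gagliardoConst * ‖f‖ₑ ^ 5 := by
  obtain ⟨F, hF, hlim⟩ := mem_closure_iff_seq_limit.mp
    ((SchwartzMap.denseRange_toLpCLM (E := ℝ) (F := ℂ) (p := 2) (μ := volume)
      ENNReal.ofNat_ne_top).closure_range.ge (Set.mem_univ f))
  choose φ hφ using hF
  have hlsc := lowerSemicontinuous_eLpNorm_schrodingerGroup_pow
  calc ∫⁻ a, eLpNorm (schrodingerGroup a f) 10 volume ^ 5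
      ≤ ∫⁻ a, liminf (fun n ↦ eLpNorm (schrodingerGroup a (F n)) 10 volume ^ 5) atTop := by
        refine lintegral_mono fun a ↦ ?_
        have hu : Tendsto (fun n ↦ (a, F n)) atTop (nhds (a, f)) := by
          exact tendsto_const_nhds.prodMk_nhds hlim
        exact (LowerSemicontinuousAt.le_liminf (hlsc (a, f))).trans
          (liminf_le_liminf_of_le hu)
    _ ≤ liminf (fun n ↦ ∫⁻ a, eLpNorm (schrodingerGroup a (F n)) 10 volume ^ 5) atTop :=
        lintegral_liminf_le fun n ↦
          (hlsc.comp (by fun_prop : Continuous fun a ↦ (a, F n))).measurable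
    _ ≤ liminf (fun n ↦ 2 ^ 6 * gagliardoConst * ‖F n‖ₑ ^ 5) atTop := by
        refine liminf_le_liminf (Eventually.of_forall fun n ↦ ?_)
        rw [← hφ n]
        exact strichartz_schwartz (φ n)
    _ = _ := by
        refine Tendsto.liminf_eq ?_
        refine ENNReal.Tendsto.const_mul ?_ (Or.inr ?_)
        · exact ((ENNReal.continuous_pow 5).tendsto _).comp hlim.enorm
        · exact ENNReal.mul_ne_top (by finiteness) gagliardoConst_ne_top

/-! ### Measurability of maps into Lebesgue spaces -/

instance fact_two_ne_top : Fact ((2 : ℝ≥0∞) ≠ ∞) := ⟨by norm_num⟩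

instance fact_five_ne_top : Fact ((5 : ℝ≥0∞) ≠ ∞) := ⟨by norm_num⟩

instance fact_ten_ne_top : Fact ((10 : ℝ≥0∞) ≠ ∞) := ⟨by norm_num⟩

/-- In a separable normed group, a map is strongly measurable as soon as its distances to all points
are measurable, because every open set is a countable union of balls. -/
theorem stronglyMeasurable_of_measurable_enorm_sub {X K : Type*} {mX : MeasurableSpace X}
    [NormedAddCommGroup K] [SecondCountableTopology K] {Φ : X → K}
    (h : ∀ g, Measurable fun x ↦ ‖Φ x - g‖ₑ) : StronglyMeasurable Φ := by
  borelize K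
  refine Measurable.stronglyMeasurable (measurable_of_isOpen fun U hU ↦ ?_)
  have hball : ∀ g : U, ∃ ε > 0, Metric.eball (g : K) ε ⊆ U := fun g ↦
    EMetric.isOpen_iff.mp hU g g.2
  choose ε hε hεU using hball
  obtain ⟨T, hT, hTU⟩ := TopologicalSpace.isOpen_iUnion_countable
    (fun g : U ↦ Metric.eball (g : K) (ε g)) (fun g ↦ Metric.isOpen_eball)
  have hU' : U = ⋃ g ∈ T, Metric.eball (g : K) (ε g) := by
    rw [hTU]
    refine Set.Subset.antisymm (fun x hx ↦ Set.mem_iUnion.mpr ⟨⟨x, hx⟩, ?_⟩)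
      (Set.iUnion_subset hεU)
    exact Metric.mem_eball_self (hε ⟨x, hx⟩)
  rw [hU', Set.preimage_iUnion₂]
  refine MeasurableSet.biUnion hT fun g _ ↦ ?_
  have : Φ ⁻¹' Metric.eball (g : K) (ε g) = {x | ‖Φ x - g‖ₑ < ε g} := by
    ext x; simp [Metric.mem_eball, edist_eq_enorm_sub]
  rw [this]
  exact measurableSet_lt (h g) measurable_const

section ToLpOrZero

variable {α E : Type*} {mα : MeasurableSpace α} [NormedAddCommGroup E]

open Classical in
/-- The class of `f` in `L^p`, or `0` if `f` is not in `L^p`. -/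
noncomputable def toLpOrZero (p : ℝ≥0∞) (μ : Measure α) (f : α → E) : Lp E p μ :=
  if h : MemLp f p μ then h.toLp f else 0

theorem coeFn_toLpOrZero {p : ℝ≥0∞} {μ : Measure α} {f : α → E} (hf : MemLp f p μ) :
    toLpOrZero p μ f =ᵐ[μ] f := by
  rw [toLpOrZero, dif_pos hf]
  exact hf.coeFn_toLp

theorem enorm_toLpOrZero_le (p : ℝ≥0∞) [Fact (1 ≤ p)] (μ : Measure α) (f : α → E) :
    ‖toLpOrZero p μ f‖ₑ ≤ eLpNorm f p μ := by
  by_cases hf : MemLp f p μ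
  · rw [Lp.enorm_def, eLpNorm_congr_ae (coeFn_toLpOrZero hf)]
  · rw [toLpOrZero, dif_neg hf]
    simp

theorem stronglyMeasurable_toLpOrZero {X : Type*} {mX : MeasurableSpace X} {p : ℝ≥0∞}
    {μ : Measure α} [Fact (1 ≤ p)] [SecondCountableTopology (Lp E p μ)] {F : X → α → E}
    (hF : ∀ x, AEStronglyMeasurable (F x) μ)
    (h : ∀ g : Lp E p μ, Measurable fun x ↦ eLpNorm (fun y ↦ F x y - g y) p μ) :
    StronglyMeasurable fun x ↦ toLpOrZero p μ (F x) := by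
  have hset : MeasurableSet {x | MemLp (F x) p μ} := by
    have h1 : ∀ x, eLpNorm (fun y ↦ F x y - (0 : Lp E p μ) y) p μ = eLpNorm (F x) p μ := by
      intro x
      refine eLpNorm_congr_ae ?_
      filter_upwards [Lp.coeFn_zero E p μ] with y hy
      simp only [hy, Pi.zero_apply, sub_zero]
    have h2 : {x | MemLp (F x) p μ} = {x | eLpNorm (fun y ↦ F x y - (0 : Lp E p μ) y) p μ < ∞} := by
      ext x
      simp only [Set.mem_ofPred_eq, h1]
      exact ⟨fun hx ↦ hx.2, fun hx ↦ ⟨hF x, hx⟩⟩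
    rw [h2]
    exact measurableSet_lt (h 0) measurable_const
  refine stronglyMeasurable_of_measurable_enorm_sub fun g ↦ ?_
  classical
  have h3 : (fun x ↦ ‖toLpOrZero p μ (F x) - g‖ₑ) = fun x ↦
      if x ∈ {x | MemLp (F x) p μ} then eLpNorm (fun y ↦ F x y - g y) p μ else ‖g‖ₑ := by
    ext x
    by_cases hx : MemLp (F x) p μ
    · rw [if_pos (show x ∈ {x | MemLp (F x) p μ} from hx), Lp.enorm_def]
      refine eLpNorm_congr_ae ?_
      filter_upwards [Lp.coeFn_sub (toLpOrZero p μ (F x)) g, coeFn_toLpOrZero hx] with y h4 h5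
      rw [h4, Pi.sub_apply, h5]
    · rw [if_neg (show x ∉ {x | MemLp (F x) p μ} from hx), toLpOrZero, dif_neg hx,
        zero_sub, enorm_neg]
  rw [h3]
  exact Measurable.ite hset (h g) measurable_const

/-- A jointly measurable function of two variables, as a map into `L^p` of the second one. -/
theorem stronglyMeasurable_toLpOrZero_of_uncurry {X : Type*} {mX : MeasurableSpace X} {p : ℝ≥0∞}
    {μ : Measure α} [SFinite μ] [Fact (1 ≤ p)] (hp : p ≠ ∞) [SecondCountableTopology (Lp E p μ)]
    {F : X → α → E} (hF : StronglyMeasurable (Function.uncurry F)) :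
    StronglyMeasurable fun x ↦ toLpOrZero p μ (F x) := by
  have hp0 : p ≠ 0 := (zero_lt_one.trans_le (Fact.out : 1 ≤ p)).ne'
  refine stronglyMeasurable_toLpOrZero
    (fun x ↦ (hF.comp_measurable measurable_prodMk_left).aestronglyMeasurable) fun g ↦ ?_
  simp_rw [eLpNorm_eq_lintegral_rpow_enorm_toReal hp0 hp]
  refine Measurable.pow_const ?_ _
  have : StronglyMeasurable fun z : X × α ↦ Function.uncurry F z - g z.2 :=
    hF.sub ((Lp.stronglyMeasurable g).comp_measurable measurable_snd)
  exact (this.enorm.pow_const _).lintegral_prod_right'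

end ToLpOrZero

theorem stronglyMeasurable_toLpOrZero_schrodingerGroup {X : Type*} {mX : MeasurableSpace X}
    {b : X → ℝ} (hb : StronglyMeasurable b) {w : X → Lp ℂ 2 (volume : Measure ℝ)}
    (hw : StronglyMeasurable w) :
    StronglyMeasurable fun x ↦
      toLpOrZero 10 (volume : Measure ℝ) (schrodingerGroup (b x) (w x) : ℝ → ℂ) := by
  let : MeasurableSpace (Lp ℂ 2 (volume : Measure ℝ)) := borel _
  have : BorelSpace (Lp ℂ 2 (volume : Measure ℝ)) := ⟨rfl⟩
  have h1 := continuous_schrodingerGroup.comp_stronglyMeasurable (hb.prodMk hw)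
  have h2 : StronglyMeasurable fun f : Lp ℂ 2 (volume : Measure ℝ) ↦
      toLpOrZero 10 (volume : Measure ℝ) (f : ℝ → ℂ) :=
    stronglyMeasurable_toLpOrZero (fun f ↦ Lp.aestronglyMeasurable f) fun g ↦
      (lowerSemicontinuous_eLpNorm_sub 10 (Lp.aestronglyMeasurable g)).measurable
  exact h2.comp_measurable h1.measurable

theorem measurable_eLpNorm_schrodingerGroup_pow_prod
    [MeasurableSpace (Lp ℂ 2 (volume : Measure ℝ))] [BorelSpace (Lp ℂ 2 (volume : Measure ℝ))] :
    Measurable fun z : ℝ × Lp ℂ 2 (volume : Measure ℝ) ↦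
      eLpNorm (schrodingerGroup z.1 z.2) 10 volume ^ 5 :=
  lowerSemicontinuous_eLpNorm_schrodingerGroup_pow.measurable

theorem measurable_eLpNorm_schrodingerGroup_pow {X : Type*} {mX : MeasurableSpace X}
    {b : X → ℝ} (hb : StronglyMeasurable b) {w : X → Lp ℂ 2 (volume : Measure ℝ)}
    (hw : StronglyMeasurable w) :
    Measurable fun x ↦ eLpNorm (schrodingerGroup (b x) (w x)) 10 volume ^ 5 := by
  let : MeasurableSpace (Lp ℂ 2 (volume : Measure ℝ)) := borel _
  have : BorelSpace (Lp ℂ 2 (volume : Measure ℝ)) := ⟨rfl⟩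
  have h2 : Measurable fun x ↦ (b x, w x) := hb.measurable.prodMk hw.measurable
  have h1 := measurable_eLpNorm_schrodingerGroup_pow_prod.comp h2
  exact h1

/-! ### Predictable processes -/

section Predictable

variable {Ω : Type*} {mΩ : MeasurableSpace Ω} {𝓕t : Filtration ℝ≥0 mΩ}

theorem predictable_le_prod (𝓕t : Filtration ℝ≥0 mΩ) :
    𝓕t.predictable ≤ (inferInstance : MeasurableSpace (ℝ≥0 × Ω)) :=
  measurableSpace_le_predictable_of_measurableSet
    (fun _ hA ↦ (measurableSet_singleton _).prod (𝓕t.le _ _ hA))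
    (fun _ _ hA ↦ measurableSet_Ioi.prod (𝓕t.le _ _ hA))

/-- An `𝓕t s`-measurable variable switched on after time `s` is predictable. -/
theorem stronglyMeasurable_predictable_indicator {K : Type*} [NormedAddCommGroup K]
    [SecondCountableTopology K] {s : ℝ≥0} {f : Ω → K} (hf : StronglyMeasurable[𝓕t s] f) :
    StronglyMeasurable[𝓕t.predictable]
      ((Set.Ioi s ×ˢ Set.univ).indicator fun z : ℝ≥0 × Ω ↦ f z.2) := by
  borelize K
  refine Measurable.stronglyMeasurable fun B hB ↦ ?_
  rw [Set.indicator_preimage, Set.ite]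
  refine MeasurableSet.union ?_ (MeasurableSet.diff ?_ ?_)
  · have : (fun z : ℝ≥0 × Ω ↦ f z.2) ⁻¹' B ∩ Set.Ioi s ×ˢ Set.univ = Set.Ioi s ×ˢ (f ⁻¹' B) := by
      ext z; simp [and_comm]
    rw [this]
    exact measurableSet_predictable_Ioi_prod (hf.measurable hB)
  · exact @measurable_const _ _ _ 𝓕t.predictable 0 B hB
  · exact measurableSet_predictable_Ioi_prod MeasurableSet.univ

theorem MeasureTheory.IsStronglyPredictable.stronglyMeasurable_uncurry_toNNReal {K : Type*}
    [TopologicalSpace K] {v : ℝ≥0 → Ω → K} (hv : IsStronglyPredictable 𝓕t v) :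
    StronglyMeasurable (Function.uncurry fun (t : ℝ) (ω : Ω) ↦ v t.toNNReal ω) := by
  have h : StronglyMeasurable (Function.uncurry v) :=
    StronglyMeasurable.mono hv (predictable_le_prod 𝓕t)
  exact h.comp_measurable (by fun_prop : Measurable fun z : ℝ × Ω ↦ (z.1.toNNReal, z.2))

/-- The Schrödinger evolution, with values in `L¹⁰`, of an `𝓕t s`-measurable datum along a
predictable process, coincides after time `s` with a predictable process. -/
theorem exists_predictable_toLpOrZero_schrodingerGroup {b : ℝ≥0 → Ω → ℝ}
    (hb : IsStronglyPredictable 𝓕t b) {s : ℝ≥0} {b₀ : Ω → ℝ} (hb₀ : StronglyMeasurable[𝓕t s] b₀)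
    {u : Ω → Lp ℂ 2 (volume : Measure ℝ)} (hu : StronglyMeasurable[𝓕t s] u) :
    ∃ v : ℝ≥0 → Ω → Lp ℂ 10 (volume : Measure ℝ), IsStronglyPredictable 𝓕t v ∧
      ∀ t > s, ∀ ω, v t ω = toLpOrZero 10 (volume : Measure ℝ)
        (schrodingerGroup (b t ω - b₀ ω) (u ω) : ℝ → ℂ) := by
  -- `b₀` and `u` are predictable only once they are switched off up to time `s`.
  refine ⟨fun t ω ↦ toLpOrZero 10 (volume : Measure ℝ)
    (schrodingerGroup (b t ω - (Set.Ioi s ×ˢ Set.univ).indicator (fun z ↦ b₀ z.2) (t, ω))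
      ((Set.Ioi s ×ˢ Set.univ).indicator (fun z ↦ u z.2) (t, ω)) : ℝ → ℂ),
    stronglyMeasurable_toLpOrZero_schrodingerGroup (mX := 𝓕t.predictable)
      (StronglyMeasurable.sub hb (stronglyMeasurable_predictable_indicator hb₀))
      (stronglyMeasurable_predictable_indicator hu), fun t ht ω ↦ ?_⟩
  have hmem : (t, ω) ∈ (Set.Ioi s ×ˢ Set.univ : Set (ℝ≥0 × Ω)) := ⟨ht, Set.mem_univ _⟩
  simp only [Set.indicator_of_mem hmem]

/-- The left end point of the interval `(k / (n + 1), (k + 1) / (n + 1)]` that contains `t`, and `0`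
for `t = 0`. -/
noncomputable def leftGridPoint (n : ℕ) (t : ℝ≥0) : ℝ≥0 :=
  ((⌈(n + 1) * t⌉₊ - 1 : ℕ) : ℝ≥0) / (n + 1)

theorem tendsto_leftGridPoint (t : ℝ≥0) :
    Tendsto (fun n ↦ leftGridPoint n t) atTop (nhds t) := by
  have hlow : ∀ n : ℕ, t - 1 / ((n : ℝ≥0) + 1) ≤ leftGridPoint n t := by
    intro n
    rw [tsub_le_iff_right, leftGridPoint, ← add_div, le_div_iff₀ (by positivity), mul_comm t]
    refine (Nat.le_ceil _).trans ?_
    have : ⌈((n : ℝ≥0) + 1) * t⌉₊ ≤ (⌈((n : ℝ≥0) + 1) * t⌉₊ - 1) + 1 := by omega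
    exact_mod_cast this
  have hup : ∀ n : ℕ, leftGridPoint n t ≤ t := by
    intro n
    rw [leftGridPoint, div_le_iff₀ (by positivity), mul_comm t]
    rcases Nat.eq_zero_or_pos ⌈((n : ℝ≥0) + 1) * t⌉₊ with h | h
    · simp [h]
    · exact (Nat.lt_ceil.mp (by omega)).le
  refine tendsto_of_tendsto_of_tendsto_of_le_of_le ?_ tendsto_const_nhds hlow hup
  have h0 : Tendsto (fun n : ℕ ↦ 1 / ((n : ℝ≥0) + 1)) atTop (nhds 0) :=
    tendsto_one_div_add_atTop_nhds_zero_nat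
  simpa using (tendsto_const_nhds (x := t)).sub h0

theorem stronglyMeasurable_comp_leftGridPoint {β : ℝ≥0 → Ω → ℝ} (hβ : StronglyAdapted 𝓕t β)
    (n : ℕ) :
    StronglyMeasurable[𝓕t.predictable] fun z : ℝ≥0 × Ω ↦ β (leftGridPoint n z.1) z.2 := by
  refine Measurable.stronglyMeasurable fun B hB ↦ ?_
  have hset : (fun z : ℝ≥0 × Ω ↦ β (leftGridPoint n z.1) z.2) ⁻¹' B =
      ({⊥} ×ˢ (β 0 ⁻¹' B)) ∪ ⋃ k : ℕ, Set.Ioc ((k : ℝ≥0) / (n + 1)) (((k : ℝ≥0) + 1) / (n + 1)) ×ˢ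
        (β ((k : ℝ≥0) / (n + 1)) ⁻¹' B) := by
    have hgrid : ∀ (k : ℕ) (t : ℝ≥0),
        t ∈ Set.Ioc ((k : ℝ≥0) / (n + 1)) (((k : ℝ≥0) + 1) / (n + 1)) →
        leftGridPoint n t = (k : ℝ≥0) / (n + 1) := by
      intro k t ht
      rw [Set.mem_Ioc, div_lt_iff₀ (by positivity), le_div_iff₀ (by positivity), mul_comm t] at ht
      have : ⌈((n : ℝ≥0) + 1) * t⌉₊ = k + 1 := by
        rw [Nat.ceil_eq_iff (by omega)]
        simpa using ht
      rw [leftGridPoint, this]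
      simp
    ext ⟨t, ω⟩
    simp only [Set.mem_preimage, Set.mem_union, Set.mem_prod, Set.mem_singleton_iff,
      Set.mem_iUnion]
    constructor
    · intro h
      rcases eq_or_ne t 0 with rfl | ht
      · left
        refine ⟨rfl, ?_⟩
        simpa [leftGridPoint] using h
      · right
        have hpos : 0 < ⌈((n : ℝ≥0) + 1) * t⌉₊ :=
          Nat.ceil_pos.mpr (mul_pos (by positivity) (pos_iff_ne_zero.mpr ht))
        have hmem : t ∈ Set.Ioc (((⌈((n : ℝ≥0) + 1) * t⌉₊ - 1 : ℕ) : ℝ≥0) / (n + 1))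
            ((((⌈((n : ℝ≥0) + 1) * t⌉₊ - 1 : ℕ) : ℝ≥0) + 1) / (n + 1)) := by
          rw [Set.mem_Ioc, div_lt_iff₀ (by positivity), le_div_iff₀ (by positivity), mul_comm t]
          refine ⟨Nat.lt_ceil.mp (by omega), (Nat.le_ceil _).trans ?_⟩
          have : ⌈((n : ℝ≥0) + 1) * t⌉₊ ≤ (⌈((n : ℝ≥0) + 1) * t⌉₊ - 1) + 1 := by omega
          exact_mod_cast this
        exact ⟨_, hmem, h⟩
    · rintro (⟨rfl, h⟩ | ⟨k, hk, h⟩)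
      · simpa [leftGridPoint] using h
      · rwa [hgrid k t hk]
  rw [hset]
  refine MeasurableSet.union ?_ (MeasurableSet.iUnion fun k ↦ ?_)
  · exact measurableSet_predictable_singleton_bot_prod ((hβ 0).measurable hB)
  · exact measurableSet_predictable_Ioc_prod _ _ ((hβ _).measurable hB)

/-- An adapted process has a predictable process that agrees with it on each continuous path, as a
limit of its values at the left end points of finer and finer grids. -/
theorem exists_predictable_eq_of_continuous {β : ℝ≥0 → Ω → ℝ} (hβ : StronglyAdapted 𝓕t β) :
    ∃ b : ℝ≥0 → Ω → ℝ, IsStronglyPredictable 𝓕t b ∧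
      ∀ ω, Continuous (β · ω) → ∀ t, b t ω = β t ω := by
  refine ⟨fun t ω ↦ limUnder atTop fun n ↦ β (leftGridPoint n t) ω, ?_, fun ω hω t ↦ ?_⟩
  · let : MeasurableSpace (ℝ≥0 × Ω) := 𝓕t.predictable
    exact StronglyMeasurable.limUnder (fun n ↦ stronglyMeasurable_comp_leftGridPoint hβ n)
  · exact ((hω.tendsto t).comp (tendsto_leftGridPoint t)).limUnder_eq

end Predictable

/-! ### Averaging over Gaussian times -/

theorem gaussianPDF_zero_le {τ : ℝ≥0} (x : ℝ) :
    gaussianPDF 0 τ x ≤ ENNReal.ofReal (√(2 * Real.pi * τ))⁻¹ := by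
  rw [gaussianPDF, gaussianPDFReal]
  refine ENNReal.ofReal_le_ofReal ?_
  refine mul_le_of_le_one_right (by positivity) (Real.exp_le_one_iff.mpr ?_)
  rw [neg_div]
  exact neg_nonpos.mpr (by positivity)

/-- The law `N(0, τ)` has a density bounded by `(2πτ)^{-1/2}`. -/
theorem lintegral_gaussianReal_zero_le {τ : ℝ≥0} (hτ : τ ≠ 0) (F : ℝ → ℝ≥0∞) (hF : Measurable F) :
    ∫⁻ x, F x ∂(gaussianReal 0 τ) ≤ ENNReal.ofReal (√(2 * Real.pi * τ))⁻¹ * ∫⁻ x, F x := by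
  rw [gaussianReal_of_var_ne_zero _ hτ,
    lintegral_withDensity_eq_lintegral_mul _ (measurable_gaussianPDF 0 τ) hF,
    ← lintegral_const_mul' _ _ ENNReal.ofReal_ne_top]
  exact lintegral_mono fun x ↦ mul_le_mul_left (gaussianPDF_zero_le x) (F x)

/-- The fifth power of `‖exp (i a Δ) f‖_{L¹⁰}`, divided by `‖f‖_{L²}`: by Strichartz, its integral
in `a` is at most of order `‖f‖⁴`. -/
noncomputable def strichartzDensity (a : ℝ) (f : Lp ℂ 2 (volume : Measure ℝ)) : ℝ≥0∞ :=
  eLpNorm (schrodingerGroup a f) 10 volume ^ 5 / ‖f‖ₑ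

theorem schrodingerGroup_zero (a : ℝ) :
    schrodingerGroup a (0 : Lp ℂ 2 (volume : Measure ℝ)) = 0 := by
  have h : symbolMul a 0 = 0 := by
    refine Lp.ext ?_
    filter_upwards [(memLp_schrodingerSymbol_mul a 0).coeFn_toLp,
      Lp.coeFn_zero ℂ 2 (volume : Measure ℝ)] with ξ h1 h2
    rw [symbolMul, h1, h2]
    simp
  rw [schrodingerGroup_eq, map_zero, h, map_zero]

theorem strichartzDensity_mul_enorm (a : ℝ) (f : Lp ℂ 2 (volume : Measure ℝ)) :
    ‖f‖ₑ * strichartzDensity a f = eLpNorm (schrodingerGroup a f) 10 volume ^ 5 := by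
  rcases eq_or_ne f 0 with rfl | hf
  · rw [schrodingerGroup_zero, eLpNorm_congr_ae (Lp.coeFn_zero ℂ 2 (volume : Measure ℝ))]
    simp
  · exact ENNReal.mul_div_cancel (by simpa using hf) (by finiteness)

theorem measurable_strichartzDensity_comp {X : Type*} {mX : MeasurableSpace X}
    {b : X → ℝ} (hb : StronglyMeasurable b) {w : X → Lp ℂ 2 (volume : Measure ℝ)}
    (hw : StronglyMeasurable w) :
    Measurable fun x ↦ strichartzDensity (b x) (w x) :=
  (measurable_eLpNorm_schrodingerGroup_pow hb hw).div hw.enorm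

theorem lintegral_strichartzDensity_le (f : Lp ℂ 2 (volume : Measure ℝ)) :
    ∫⁻ a, strichartzDensity a f ≤ 2 ^ 6 * gagliardoConst * ‖f‖ₑ ^ 4 := by
  rcases eq_or_ne f 0 with rfl | hf
  · have h : ∀ a, strichartzDensity a (0 : Lp ℂ 2 (volume : Measure ℝ)) = 0 := by
      intro a
      rw [strichartzDensity, schrodingerGroup_zero,
        eLpNorm_congr_ae (Lp.coeFn_zero ℂ 2 (volume : Measure ℝ))]
      simp
    simp [h]
  · have hf0 : ‖f‖ₑ ≠ 0 := by simpa using hf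
    simp only [strichartzDensity, div_eq_mul_inv]
    rw [lintegral_mul_const' _ _ (by simpa using hf), ← div_eq_mul_inv]
    refine ENNReal.div_le_of_le_mul ((strichartz f).trans (le_of_eq (by ring)))

/-- An independent Gaussian time of variance `τ`: condition on the datum, and bound the density
of the time. -/
theorem lintegral_strichartzDensity_comp_le {Ω : Type*} {m mΩ : MeasurableSpace Ω} {P : Measure Ω}
    [IsProbabilityMeasure P] {X : Ω → ℝ} (hX : Measurable X) {τ : ℝ≥0} (hτ : τ ≠ 0)
    (hlaw : P.map X = gaussianReal 0 τ) (hm : m ≤ mΩ)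
    (hind : Indep (MeasurableSpace.comap X inferInstance) m P)
    {u : Ω → Lp ℂ 2 (volume : Measure ℝ)} (hu : StronglyMeasurable[m] u) :
    ∫⁻ ω, strichartzDensity (X ω) (u ω) ∂P ≤
      ENNReal.ofReal (√(2 * Real.pi * τ))⁻¹ *
        (2 ^ 6 * gagliardoConst * ∫⁻ ω, ‖u ω‖ₑ ^ 4 ∂P) := by
  let : MeasurableSpace (Lp ℂ 2 (volume : Measure ℝ)) := borel _
  have : BorelSpace (Lp ℂ 2 (volume : Measure ℝ)) := ⟨rfl⟩
  have hum : Measurable u := (hu.mono hm).measurable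
  have hXu : IndepFun X u P := by
    rw [IndepFun_iff_Indep]
    exact indep_of_indep_of_le_right hind (hu.measurable.comap_le)
  have hprod : P.map (fun ω ↦ (X ω, u ω)) = (P.map X).prod (P.map u) :=
    (indepFun_iff_map_prod_eq_prod_map_map hX.aemeasurable hum.aemeasurable).mp hXu
  have : IsProbabilityMeasure (P.map u) := Measure.isProbabilityMeasure_map hum.aemeasurable
  have hΨ : Measurable fun z : ℝ × Lp ℂ 2 (volume : Measure ℝ) ↦ strichartzDensity z.1 z.2 :=
    measurable_eLpNorm_schrodingerGroup_pow_prod.div measurable_snd.enorm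
  calc ∫⁻ ω, strichartzDensity (X ω) (u ω) ∂P
      = ∫⁻ z, strichartzDensity z.1 z.2 ∂(P.map fun ω ↦ (X ω, u ω)) :=
        (lintegral_map hΨ (hX.prodMk hum)).symm
    _ = ∫⁻ f, ∫⁻ a, strichartzDensity a f ∂(gaussianReal 0 τ) ∂(P.map u) := by
        rw [hprod, hlaw, lintegral_prod_symm' _ hΨ]
    _ ≤ ∫⁻ f, ENNReal.ofReal (√(2 * Real.pi * τ))⁻¹ *
          (2 ^ 6 * gagliardoConst * ‖f‖ₑ ^ 4) ∂(P.map u) := by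
        refine lintegral_mono fun f ↦ ?_
        refine (lintegral_gaussianReal_zero_le hτ _ (hΨ.comp measurable_prodMk_right)).trans ?_
        exact mul_le_mul_right (lintegral_strichartzDensity_le f) _
    _ = _ := by
        rw [lintegral_map (by fun_prop) hum, lintegral_const_mul' _ _ ENNReal.ofReal_ne_top,
          lintegral_const_mul' _ _ (ENNReal.mul_ne_top (by finiteness) gagliardoConst_ne_top)]

theorem lintegral_inv_sqrt_le (s T : ℝ≥0) :
    ∫⁻ t in Set.Ioo (s : ℝ) (s + T : ℝ≥0),
      ENNReal.ofReal (√(2 * Real.pi * ((t.toNNReal - s : ℝ≥0) : ℝ)))⁻¹ ≤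
        ENNReal.ofReal ((T : ℝ) ^ (1 / 2 : ℝ)) := by
  have hint : IntervalIntegrable (fun t : ℝ ↦ (1 / 2) * (t - s) ^ (-(1 / 2) : ℝ)) volume
      (s : ℝ) (s + T) := by
    have h1 : IntervalIntegrable (fun t : ℝ ↦ t ^ (-(1 / 2) : ℝ)) volume 0 T :=
      intervalIntegral.intervalIntegrable_rpow' (by norm_num)
    have h2 := (h1.comp_sub_right (s : ℝ)).const_mul (1 / 2)
    rwa [zero_add, add_comm] at h2
  have hval : ∫ t in (s : ℝ)..(s + T), (1 / 2) * (t - s) ^ (-(1 / 2) : ℝ) =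
      (T : ℝ) ^ (1 / 2 : ℝ) := by
    rw [intervalIntegral.integral_const_mul,
      intervalIntegral.integral_comp_sub_right (fun t ↦ t ^ (-(1 / 2) : ℝ)),
      integral_rpow (Or.inl (by norm_num))]
    norm_num
    ring
  have hsT : (s : ℝ) ≤ s + T := by simp
  rw [← hval, intervalIntegral.integral_of_le hsT, integral_Ioc_eq_integral_Ioo,
    ofReal_integral_eq_lintegral_ofReal]
  · rw [NNReal.coe_add]
    refine setLIntegral_mono' measurableSet_Ioo fun t ht ↦ ENNReal.ofReal_le_ofReal ?_
    have hts : 0 < t - s := sub_pos.mpr ht.1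
    have ht0 : 0 ≤ t := s.2.trans ht.1.le
    have hcoe : ((t.toNNReal - s : ℝ≥0) : ℝ) = t - s := by
      rw [NNReal.coe_sub (NNReal.le_toNNReal_of_coe_le ht.1.le), Real.coe_toNNReal t ht0]
    rw [hcoe, Real.rpow_neg hts.le, ← Real.sqrt_eq_rpow, Real.sqrt_mul (by positivity),
      mul_inv]
    gcongr
    -- `√(2π) ≥ 2`, and `x^{-1/2} / 2` is the derivative of `x^{1/2}`.
    rw [one_div]
    refine inv_anti₀ (by norm_num) (Real.le_sqrt_of_sq_le ?_)
    nlinarith [Real.pi_gt_three]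
  · exact (intervalIntegrable_iff_integrableOn_Ioo_of_le hsT).mp hint
  · filter_upwards [ae_restrict_mem measurableSet_Ioo] with t ht
    have := sub_pos.mpr ht.1
    simp only [Pi.zero_apply]
    positivity

/-! ### The stochastic Strichartz estimate -/

section WhiteNoise

variable {Ω : Type*} {mΩ : MeasurableSpace Ω} {P : Measure Ω}

theorem IsBrownianRelTo.measurable_sub {𝓕t : Filtration ℝ≥0 mΩ} {β : ℝ≥0 → Ω → ℝ}
    (hβ : IsBrownianRelTo β 𝓕t P) (s t : ℝ≥0) : Measurable fun ω ↦ β t ω - β s ω :=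
  ((hβ.adapted t).mono (𝓕t.le t)).measurable.sub ((hβ.adapted s).mono (𝓕t.le s)).measurable

theorem IsBrownianRelTo.map_sub {𝓕t : Filtration ℝ≥0 mΩ} {β : ℝ≥0 → Ω → ℝ}
    (hβ : IsBrownianRelTo β 𝓕t P) {s t : ℝ≥0} (hst : s ≤ t) :
    P.map (fun ω ↦ β t ω - β s ω) = gaussianReal 0 (t - s) := by
  have h := (hβ.isBrownian.hasLaw_sub t s).map_eq
  have hd : nndist t.1 s.1 = t - s := by
    ext
    rw [coe_nndist, Real.dist_eq, NNReal.coe_sub hst, abs_of_nonneg]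
    · rfl
    · exact sub_nonneg.mpr hst
  rw [hd] at h
  exact h

/-- Hölder's inequality, after `‖exp (i B Δ) u‖⁵ = ‖u‖ * strichartzDensity B u`. -/
theorem lintegral_schrodingerGroup_rpow_le [SFinite P] {ν : Measure ℝ} [SFinite ν] {B : ℝ → Ω → ℝ}
    (hB : StronglyMeasurable (Function.uncurry B)) {u : Ω → Lp ℂ 2 (volume : Measure ℝ)}
    (hu : StronglyMeasurable u) :
    ∫⁻ ω, (∫⁻ t, eLpNorm (schrodingerGroup (B t ω) (u ω)) 10 volume ^ 5 ∂ν) ^ (4 / 5 : ℝ) ∂P ≤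
      (∫⁻ ω, ‖u ω‖ₑ ^ 4 ∂P) ^ (1 / 5 : ℝ) *
        (∫⁻ t, ∫⁻ ω, strichartzDensity (B t ω) (u ω) ∂P ∂ν) ^ (4 / 5 : ℝ) := by
  have hm : Measurable fun z : ℝ × Ω ↦ strichartzDensity (B z.1 z.2) (u z.2) :=
    measurable_strichartzDensity_comp hB (hu.comp_measurable measurable_snd)
  have hswap : ∫⁻ t, ∫⁻ ω, strichartzDensity (B t ω) (u ω) ∂P ∂ν =
      ∫⁻ ω, ∫⁻ t, strichartzDensity (B t ω) (u ω) ∂ν ∂P :=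
    lintegral_lintegral_swap hm.aemeasurable
  rw [hswap]
  refine le_trans (le_of_eq (lintegral_congr fun ω ↦ ?_)) (ENNReal.lintegral_mul_norm_pow_le
    (hu.enorm.pow_const 4).aemeasurable hm.lintegral_prod_left'.aemeasurable
    (by norm_num) (by norm_num) (by norm_num))
  simp_rw [← strichartzDensity_mul_enorm]
  rw [lintegral_const_mul' _ _ (by finiteness), ENNReal.mul_rpow_of_nonneg _ _ (by norm_num),
    ← ENNReal.rpow_natCast, ← ENNReal.rpow_mul]
  norm_num

/-- The constant of `strichartz`, for the fifth powers of the norms. -/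
noncomputable def strichartzConst : ℝ≥0∞ := 2 ^ 6 * gagliardoConst

theorem strichartzConst_ne_top : strichartzConst ≠ ∞ :=
  ENNReal.mul_ne_top (by finiteness) gagliardoConst_ne_top

theorem lintegral_whiteNoise_rpow_le [IsProbabilityMeasure P] {𝓕t : Filtration ℝ≥0 mΩ}
    {β : ℝ≥0 → Ω → ℝ} (hβ : IsBrownianRelTo β 𝓕t P) (s T : ℝ≥0) {B : ℝ → Ω → ℝ}
    (hB : StronglyMeasurable (Function.uncurry B))
    (hBβ : ∀ᵐ ω ∂P, ∀ t, B t ω = β t.toNNReal ω - β s ω)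
    {u : Ω → Lp ℂ 2 (volume : Measure ℝ)} (hu : StronglyMeasurable[𝓕t s] u) :
    ∫⁻ ω, (∫⁻ t in Set.Ioo (s : ℝ) (s + T : ℝ≥0),
        eLpNorm (schrodingerGroup (B t ω) (u ω)) 10 volume ^ 5) ^ (4 / 5 : ℝ) ∂P ≤
      (∫⁻ ω, ‖u ω‖ₑ ^ 4 ∂P) ^ (1 / 5 : ℝ) *
        (ENNReal.ofReal ((T : ℝ) ^ (1 / 2 : ℝ)) *
          (strichartzConst * ∫⁻ ω, ‖u ω‖ₑ ^ 4 ∂P)) ^ (4 / 5 : ℝ) := by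
  refine (lintegral_schrodingerGroup_rpow_le hB (hu.mono (𝓕t.le s))).trans ?_
  gcongr
  calc ∫⁻ t in Set.Ioo (s : ℝ) (s + T : ℝ≥0), ∫⁻ ω, strichartzDensity (B t ω) (u ω) ∂P
      ≤ ∫⁻ t in Set.Ioo (s : ℝ) (s + T : ℝ≥0),
          ENNReal.ofReal (√(2 * Real.pi * ((t.toNNReal - s : ℝ≥0) : ℝ)))⁻¹ *
            (strichartzConst * ∫⁻ ω, ‖u ω‖ₑ ^ 4 ∂P) := by
        refine setLIntegral_mono' measurableSet_Ioo fun t ht ↦ ?_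
        have hst : s < t.toNNReal := Real.lt_toNNReal_iff_coe_lt.mpr ht.1
        refine le_trans (le_of_eq ?_) (lintegral_strichartzDensity_comp_le
          (hβ.measurable_sub s t.toNNReal) (tsub_pos_of_lt hst).ne' (hβ.map_sub hst.le) (𝓕t.le s)
          (hβ.indep s t.toNNReal hst.le) hu)
        refine lintegral_congr_ae ?_
        filter_upwards [hBβ] with ω hω
        rw [hω]
    _ = (∫⁻ t in Set.Ioo (s : ℝ) (s + T : ℝ≥0),
          ENNReal.ofReal (√(2 * Real.pi * ((t.toNNReal - s : ℝ≥0) : ℝ)))⁻¹) *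
            (strichartzConst * ∫⁻ ω, ‖u ω‖ₑ ^ 4 ∂P) :=
        lintegral_mul_const _ (by fun_prop)
    _ ≤ _ := by
        gcongr
        exact lintegral_inv_sqrt_le s T

end WhiteNoise

theorem moment_bound_rpow_eq (T : ℝ≥0) (K U : ℝ≥0∞) :
    (U ^ (1 / 5 : ℝ) * (ENNReal.ofReal ((T : ℝ) ^ (1 / 2 : ℝ)) * (K * U)) ^ (4 / 5 : ℝ)) ^
        (1 / 4 : ℝ) =
      K ^ (1 / 5 : ℝ) * ENNReal.ofReal ((T : ℝ) ^ (1 / 10 : ℝ)) * U ^ (1 / 4 : ℝ) := by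
  have hT : ENNReal.ofReal ((T : ℝ) ^ (1 / 10 : ℝ)) =
      ENNReal.ofReal ((T : ℝ) ^ (1 / 2 : ℝ)) ^ (1 / 5 : ℝ) := by
    rw [ENNReal.ofReal_rpow_of_nonneg (by positivity) (by norm_num), ← Real.rpow_mul T.coe_nonneg]
    norm_num
  have hU : U ^ (1 / 4 : ℝ) = U ^ (1 / 20 : ℝ) * U ^ (1 / 5 : ℝ) := by
    rw [← ENNReal.rpow_add_of_nonneg _ _ (by norm_num) (by norm_num)]
    norm_num
  rw [hT, hU]
  simp only [ENNReal.mul_rpow_of_nonneg _ _ (by norm_num : (0 : ℝ) ≤ 4 / 5),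
    ENNReal.mul_rpow_of_nonneg _ _ (by norm_num : (0 : ℝ) ≤ 1 / 4), ← ENNReal.rpow_mul]
  norm_num
  ring

theorem proposition3 :
    ∃ c : ℝ, 0 < c ∧
      ∀ (Ω : Type*) (mΩ : MeasurableSpace Ω) (P : Measure Ω) (_ : IsProbabilityMeasure P)
        (𝓕t : Filtration ℝ≥0 mΩ) (β : ℝ≥0 → Ω → ℝ) (_ : IsBrownianRelTo β 𝓕t P)
        (s T : ℝ≥0) (u : Ω → Lp ℂ 2 (volume : Measure ℝ))
        (_ : AEStronglyMeasurable[𝓕t s] u P) (_ : MemLp u 4 P),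
        ∃ V : Ω → Lp (Lp ℂ 10 (volume : Measure ℝ)) 5
            ((volume : Measure ℝ).restrict (Set.Ioo (s : ℝ) (s + T : ℝ≥0))),
          MemPredictableLp 𝓕t P 4 5 s (s + T) V ∧
          (∀ᵐ ω ∂P, ∀ᵐ t ∂((volume : Measure ℝ).restrict (Set.Ioo (s : ℝ) (s + T : ℝ≥0))),
            (V ω t : ℝ → ℂ) =ᵐ[volume]
              (whiteNoisePropagator β t.toNNReal s ω (u ω) : ℝ → ℂ)) ∧
          eLpNorm V 4 P ≤
            ENNReal.ofReal (c * (T : ℝ) ^ (1 / 10 : ℝ)) * eLpNorm u 4 P := by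
  refine ⟨strichartzConst.toReal ^ (1 / 5 : ℝ) + 1, by positivity, ?_⟩
  intro Ω mΩ P _ 𝓕t β hβ s T u hu hu4
  obtain ⟨u', hu', huu'⟩ := hu
  obtain ⟨b, hb, hbβ⟩ := exists_predictable_eq_of_continuous hβ.adapted
  set I : Set ℝ := Set.Ioo (s : ℝ) (s + T : ℝ≥0) with hI
  -- `b` and `v` are predictable and, for almost every `ω`, equal to `β` and, after time `s`, to the
  -- class of `S(t, s) u`.
  obtain ⟨v, hvpred, hvs⟩ :=
    exists_predictable_toLpOrZero_schrodingerGroup hb (hβ.adapted s) hu'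
  have hvjoint : StronglyMeasurable (Function.uncurry fun (ω : Ω) (t : ℝ) ↦ v t.toNNReal ω) :=
    hvpred.stronglyMeasurable_uncurry_toNNReal.comp_measurable measurable_swap
  obtain ⟨B, hBdef⟩ : ∃ B : ℝ → Ω → ℝ, ∀ t ω, B t ω = b t.toNNReal ω - β s ω := ⟨_, fun _ _ ↦ rfl⟩
  have hB : StronglyMeasurable (Function.uncurry B) := by
    have h1 : Function.uncurry B = fun z ↦
        Function.uncurry (fun (t : ℝ) (ω : Ω) ↦ b t.toNNReal ω) z - β s z.2 :=
      funext fun z ↦ hBdef z.1 z.2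
    rw [h1]
    exact hb.stronglyMeasurable_uncurry_toNNReal.sub
      (((hβ.adapted s).mono (𝓕t.le s)).comp_measurable measurable_snd)
  have hBβ : ∀ᵐ ω ∂P, ∀ t, B t ω = β t.toNNReal ω - β s ω := by
    filter_upwards [hβ.isBrownian.cont] with ω hω t
    rw [hBdef, hbβ ω hω]
  -- `Z` dominates the fifth power of the norm of `V`; where it is finite, `v` is in
  -- `L⁵(s, s + T; L¹⁰)`.
  set Z : Ω → ℝ≥0∞ := fun ω ↦
    ∫⁻ t in I, eLpNorm (schrodingerGroup (B t ω) (u' ω)) 10 volume ^ 5 with hZ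
  have hNm : Measurable fun z : ℝ × Ω ↦
      eLpNorm (schrodingerGroup (B z.1 z.2) (u' z.2)) 10 volume ^ 5 :=
    measurable_eLpNorm_schrodingerGroup_pow (b := fun z : ℝ × Ω ↦ B z.1 z.2)
      (w := fun z ↦ u' z.2) hB
      ((hu'.mono (𝓕t.le s)).comp_measurable measurable_snd)
  have hZm : Measurable Z := hNm.lintegral_prod_left'
  have hvB : ∀ t ∈ I, ∀ ω, v t.toNNReal ω =
      toLpOrZero 10 (volume : Measure ℝ) (schrodingerGroup (B t ω) (u' ω) : ℝ → ℂ) := by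
    intro t ht ω
    rw [hvs _ (Real.lt_toNNReal_iff_coe_lt.mpr ht.1), hBdef]
  have hvZ : ∀ ω, eLpNorm (fun t : ℝ ↦ v t.toNNReal ω) 5 (volume.restrict I) ≤
      Z ω ^ (1 / 5 : ℝ) := by
    intro ω
    rw [eLpNorm_eq_lintegral_rpow_enorm_toReal (by norm_num) (by norm_num)]
    simp only [ENNReal.toReal_ofNat]
    refine ENNReal.rpow_le_rpow (setLIntegral_mono' measurableSet_Ioo fun t ht ↦ ?_) (by norm_num)
    rw [hvB t ht, ← ENNReal.rpow_natCast]
    exact ENNReal.rpow_le_rpow (enorm_toLpOrZero_le _ _ _) (by norm_num)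
  set V : Ω → Lp (Lp ℂ 10 (volume : Measure ℝ)) 5 ((volume : Measure ℝ).restrict I) :=
    fun ω ↦ toLpOrZero 5 (volume.restrict I) (fun t : ℝ ↦ v t.toNNReal ω) with hV
  have hVm : StronglyMeasurable V :=
    stronglyMeasurable_toLpOrZero_of_uncurry (by norm_num) hvjoint
  set U : ℝ≥0∞ := ∫⁻ ω, ‖u' ω‖ₑ ^ 4 ∂P with hU
  have hUu : U ^ (1 / 4 : ℝ) = eLpNorm u 4 P := by
    rw [eLpNorm_congr_ae huu', eLpNorm_eq_lintegral_rpow_enorm_toReal (by norm_num) (by norm_num)]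
    simp [hU]
  have hUtop : U ≠ ∞ := by
    intro h
    rw [h] at hUu
    exact hu4.2.ne (by rw [← hUu]; simp)
  have hmoment : ∫⁻ ω, Z ω ^ (4 / 5 : ℝ) ∂P ≤ U ^ (1 / 5 : ℝ) *
      (ENNReal.ofReal ((T : ℝ) ^ (1 / 2 : ℝ)) * (strichartzConst * U)) ^ (4 / 5 : ℝ) :=
    lintegral_whiteNoise_rpow_le hβ s T hB hBβ hu'
  have hZfin : ∀ᵐ ω ∂P, Z ω < ∞ := by
    have h1 : ∫⁻ ω, Z ω ^ (4 / 5 : ℝ) ∂P ≠ ∞ := by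
      refine ne_top_of_le_ne_top (ENNReal.mul_ne_top ?_ ?_) hmoment
      · exact ENNReal.rpow_ne_top_of_nonneg (by norm_num) hUtop
      · exact ENNReal.rpow_ne_top_of_nonneg (by norm_num)
          (ENNReal.mul_ne_top ENNReal.ofReal_ne_top
            (ENNReal.mul_ne_top strichartzConst_ne_top hUtop))
    filter_upwards [ae_lt_top (hZm.pow_const _) h1] with ω hω
    exact (ENNReal.rpow_lt_top_iff_of_pos (by norm_num)).mp hω
  have hVv : ∀ᵐ ω ∂P, ∀ᵐ t ∂((volume : Measure ℝ).restrict I), V ω t = v t.toNNReal ω := by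
    filter_upwards [hZfin] with ω hω
    refine coeFn_toLpOrZero ⟨(hvjoint.comp_measurable measurable_prodMk_left).aestronglyMeasurable,
      (hvZ ω).trans_lt ?_⟩
    exact ENNReal.rpow_lt_top_of_nonneg (by norm_num) hω.ne
  have hbound : eLpNorm V 4 P ≤ ENNReal.ofReal ((strichartzConst.toReal ^ (1 / 5 : ℝ) + 1) *
      (T : ℝ) ^ (1 / 10 : ℝ)) * eLpNorm u 4 P := by
    have h1 : eLpNorm V 4 P ≤ (∫⁻ ω, Z ω ^ (4 / 5 : ℝ) ∂P) ^ (1 / 4 : ℝ) := by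
      rw [eLpNorm_eq_lintegral_rpow_enorm_toReal (by norm_num) (by norm_num)]
      simp only [ENNReal.toReal_ofNat]
      refine ENNReal.rpow_le_rpow (lintegral_mono fun ω ↦ ?_) (by norm_num)
      calc ‖V ω‖ₑ ^ (4 : ℝ) ≤ (Z ω ^ (1 / 5 : ℝ)) ^ (4 : ℝ) :=
            ENNReal.rpow_le_rpow ((enorm_toLpOrZero_le _ _ _).trans (hvZ ω)) (by norm_num)
        _ = Z ω ^ (4 / 5 : ℝ) := by rw [← ENNReal.rpow_mul]; norm_num
    refine h1.trans ((ENNReal.rpow_le_rpow hmoment (by norm_num)).trans ?_)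
    rw [moment_bound_rpow_eq, hUu]
    gcongr
    rw [ENNReal.ofReal_mul (by positivity)]
    gcongr
    rw [ENNReal.ofReal_add (by positivity) zero_le_one, ← ENNReal.ofReal_rpow_of_nonneg
      ENNReal.toReal_nonneg (by norm_num), ENNReal.ofReal_toReal strichartzConst_ne_top]
    exact le_self_add
  refine ⟨V, ⟨⟨hVm.aestronglyMeasurable, hbound.trans_lt
    (ENNReal.mul_lt_top ENNReal.ofReal_lt_top hu4.2)⟩, v, hvpred, hVv⟩, ?_, hbound⟩
  filter_upwards [hVv, hZfin, hBβ, huu'] with ω h1 h2 h3 h4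
  have h5 : ∀ᵐ t ∂((volume : Measure ℝ).restrict I),
      eLpNorm (schrodingerGroup (B t ω) (u' ω)) 10 volume ^ 5 < ∞ :=
    ae_lt_top (measurable_eLpNorm_schrodingerGroup_pow (b := fun t ↦ B t ω) (w := fun _ ↦ u' ω)
      (hB.comp_measurable measurable_prodMk_right) stronglyMeasurable_const) h2.ne
  filter_upwards [h1, h5, ae_restrict_mem measurableSet_Ioo] with t h6 h7 h8
  rw [h6, hvB t h8, whiteNoisePropagator, ← h3, h4]
  exact coeFn_toLpOrZero ⟨Lp.aestronglyMeasurable _, by simpa using h7⟩
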